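/- Let $\Omega\subset\mathbb R^2$ be a bounded domain (open and connected) whose boundary $\Gamma=\partial\Omega$ is a simple closed polygon. For $d_I\in(0,e^{-1})$ let $\sigma(x)=d_I+\operatorname{dist}(x,\Gamma)$ be the regularized distance to the boundary. Let $H^1_0(\Omega)$ be the completion of $C_0^\infty(\Omega)$ with respect to the $H^1(\Omega)$-norm. Then there is a constant $c>0$, depending only on $\Omega$ (in particular independent of $d_I$, $f$ and $u$), such that for every $d_I\in(0,e^{-1})$, every $f\in L^2(\Omega)$ and the weak solution $u\in H^1_0(\Omega)$ of the Dirichlet problem for the Poisson equation, that is, $$(\nabla u,\nabla v)_{L^2(\Omega)}=(f,v)_{L^2(\Omega)}\qquad\text{for all } v\in H^1_0(\Omega),$$ the following holds: (i) $\displaystyle \|\sigma^{-1}u\|_{L^2(\Omega)}+\|\nabla u\|_{L^2(\Omega)}\le c\,\|\sigma f\|_{L^2(\Omega)}$; (ii) if $\Omega$ is convex, then $\displaystyle \|\sigma^{-1/2}u\|_{L^2(\Omega)}+|\ln d_I|\,\|\sigma^{1/2}\nabla u\|_{L^2(\Omega)}\le c\,|\ln d_I|^2\,\|\sigma^{3/2}f\|_{L^2(\Omega)}$.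 -/

import Mathlib

open MeasureTheory Filter Topology
open scoped ENNReal ContDiff

/-- The Euclidean plane. -/
abbrev Plane : Type := EuclideanSpace ℝ (Fin 2)

/-- A simple closed polygon in the plane: at least three vertices, pairwise distinct, and two
different edges have no point in common except a common endpoint. -/
structure IsSimplePolygon {n : ℕ} (P : Polygon Plane n) : Prop where
  three_le : 3 ≤ n
  vertices_injective : Function.Injective P.vertices
  edge_inter_subset : ∀ i j : Fin n, i ≠ j →
    P.edgeSet ℝ i ∩ P.edgeSet ℝ j ⊆ {P i, P (finRotate n i)} ∩ {P j, P (finRotate n j)}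

/-- A bounded domain in the plane whose boundary is a simple closed polygon. -/
structure IsPolygonalDomain (Ω : Set Plane) : Prop where
  isOpen : IsOpen Ω
  isConnected : IsConnected Ω
  isBounded : Bornology.IsBounded Ω
  frontier_eq : ∃ (n : ℕ) (P : Polygon Plane n), IsSimplePolygon P ∧ frontier Ω = P.boundary ℝ

/-- Smooth functions with compact support contained in `Ω`. -/
structure IsTestFunction (Ω : Set Plane) (φ : Plane → ℝ) : Prop where
  contDiff : ContDiff ℝ ∞ φ
  hasCompactSupport : HasCompactSupport φ
  tsupport_subset : tsupport φ ⊆ Ω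

/-- The function `u` belongs to `H¹₀(Ω)` and has the gradient `Du`, where `H¹₀(Ω)` is the completion
of the test functions with respect to the `H¹(Ω)`-norm: some sequence of test functions tends to `u`
in `L²(Ω)` while its gradients tend to `Du` in `L²(Ω)`. Only the values on `Ω` matter, and
`Du` is determined by `u` almost everywhere in `Ω`. -/
structure MemH10 (Ω : Set Plane) (u : Plane → ℝ) (Du : Plane → Plane) : Prop where
  memLp : MemLp u 2 (volume.restrict Ω)
  memLp_grad : MemLp Du 2 (volume.restrict Ω)
  exists_approx : ∃ φ : ℕ → Plane → ℝ, (∀ k, IsTestFunction Ω (φ k)) ∧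
    Tendsto (fun k => eLpNorm (fun x => φ k x - u x) 2 (volume.restrict Ω)) atTop (𝓝 0) ∧
    Tendsto (fun k => eLpNorm (fun x => gradient (φ k) x - Du x) 2 (volume.restrict Ω)) atTop (𝓝 0)

/-- The function `u ∈ H¹₀(Ω)`, with gradient `Du`, is the weak solution of `-Δu = f` in `Ω`,
`u = 0` on the boundary. -/
structure IsWeakSolution (Ω : Set Plane) (f u : Plane → ℝ) (Du : Plane → Plane) : Prop where
  memH10 : MemH10 Ω u Du
  weak_form : ∀ (v : Plane → ℝ) (Dv : Plane → Plane), MemH10 Ω v Dv →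
    ∫ x in Ω, inner ℝ (Du x) (Dv x) = ∫ x in Ω, f x * v x

/-- The regularized distance `σ(x) = d + dist(x, ∂Ω)` to the boundary. -/
noncomputable def regDist (Ω : Set Plane) (d : ℝ) (x : Plane) : ℝ :=
  d + Metric.infDist x (frontier Ω)

/-- The norm `‖σ ^ s w‖` in `L²(Ω)` for the regularized distance `σ`, with values in `[0, ∞]`. -/
noncomputable def weightedL2Norm {F : Type*} [NormedAddCommGroup F] [NormedSpace ℝ F]
    (Ω : Set Plane) (d s : ℝ) (w : Plane → F) : ℝ≥0∞ :=
  eLpNorm (fun x => regDist Ω d x ^ s • w x) 2 (volume.restrict Ω)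

/-!
The first estimate rests on Hardy's inequality `‖u / δ‖ ≤ C ‖∇u‖`, where `δ` is the distance to the
boundary: testing the equation with `u` gives `‖∇u‖² = (f, u) ≤ ‖σ f‖ ‖u / σ‖ ≤ C ‖σ f‖ ‖∇u‖`.
For a polygon, Hardy's inequality follows from its one-dimensional form in finitely many directions.
At each vertex there is a direction `ν` such that the line through a nearby point `x` with
direction `ν` meets one of the two edges at this vertex within a multiple of `δ(x)`
(`exists_direction_of_corner`, `IsPolygonalDomain.exists_directions`). Along such lines the time at
which `Ω` is left grows with speed one, and integrating the derivative of `φ² / exitTime` gives the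
inequality (`IsTestFunction.hardy_exitTime`).

In a convex domain `σ` is concave, hence superharmonic: `∫ ∇w · ∇σ ≥ 0` for nonnegative Lipschitz
functions `w` with compact support (`integral_inner_gradient_regDist_nonneg`). With
`w = φ² log (S / σ)`, where `S` is an upper bound of `σ`, and `|∇σ| = 1` this yields the
critical Hardy inequality `‖σ^(-1/2) u‖ ≤ 2 log (S / d) ‖σ^(1/2) ∇u‖`
(`IsTestFunction.weighted_hardy`). Testing the equation with `σ u` yields
`‖σ^(1/2) ∇u‖² ≤ (f, σ u) ≤ ‖σ^(3/2) f‖ ‖σ^(-1/2) u‖`, as the additional term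
`(∇u, u ∇σ) = (∇(u²), ∇σ) / 2` is nonnegative (`IsWeakSolution.integral_regDist_mul_sq_le`).
The second estimate is obtained by combining the two inequalities. The functions `σ φ`, with a test
function `φ`, are only Lipschitz; they are admitted in the weak formulation after mollification
(`IsWeakSolution.weak_form_of_lipschitz`).
-/

/-! ### Polygons: the complement is reached in finitely many directions -/

/-- If `n ≠ 0`, every vector of the plane orthogonal to `n` is a multiple of the vector obtained
from `n` by a quarter turn. -/
lemma exists_smul_quarterTurn_eq {n p : Plane} (hn : n ≠ 0) (h : inner ℝ n p = 0) :
    ∃ t : ℝ, p = t • (!₂[-n 1, n 0] : Plane) ∧ ‖p‖ = |t| * ‖n‖ := by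
  have hn2 : n 0 ^ 2 + n 1 ^ 2 ≠ 0 := by
    intro h0
    apply hn
    have h1 : n 0 = 0 := by nlinarith [sq_nonneg (n 0), sq_nonneg (n 1)]
    have h2 : n 1 = 0 := by nlinarith [sq_nonneg (n 0), sq_nonneg (n 1)]
    ext i
    fin_cases i <;> simp [h1, h2]
  have h' : n 0 * p 0 + n 1 * p 1 = 0 := by
    simpa [PiLp.inner_apply, Fin.sum_univ_two, mul_comm] using h
  have hp : p = ((p 1 * n 0 - p 0 * n 1) / (n 0 ^ 2 + n 1 ^ 2)) • (!₂[-n 1, n 0] : Plane) := by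
    ext i
    fin_cases i
    · simp
      field_simp
      linear_combination n 0 * h'
    · simp
      field_simp
      linear_combination n 1 * h'
  refine ⟨_, hp, ?_⟩
  conv_lhs => rw [hp]
  rw [norm_smul, Real.norm_eq_abs]
  congr 1
  simp [EuclideanSpace.norm_eq, Fin.sum_univ_two, add_comm]

/-- Near a vertex `A` of a polygon with edges `[A, A + e₁]` and `[A, A + e₂]`, which do not leave
`A` in the same direction, one direction `ν` suffices: from a point `x` whose distance to some point
of the first half of `[A, A + e₁]` is `r ≤ ε`, the line with direction `ν` meets one of the two
edges within a time `C * r`. The direction is chosen such that the edges lie strictly on different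
sides of the line through `A`. -/
lemma exists_direction_of_corner {A e₁ e₂ : Plane} (h : ¬ SameRay ℝ e₁ e₂) :
    ∃ ν : Plane, ν ≠ 0 ∧ ∃ C : ℝ, 0 < C ∧ ∃ ε : ℝ, 0 < ε ∧ ∀ (x : Plane) (s : ℝ),
      0 ≤ s → s ≤ 1 / 2 → dist x (A + s • e₁) ≤ ε → ∃ t : ℝ, |t| ≤ C * dist x (A + s • e₁) ∧
        ∃ τ : ℝ, 0 ≤ τ ∧ τ ≤ 1 ∧ (x + t • ν = A + τ • e₁ ∨ x + t • ν = A + τ • e₂) := by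
  have h1 : e₁ ≠ 0 := fun h0 => h (h0 ▸ SameRay.zero_left _)
  have h2 : e₂ ≠ 0 := fun h0 => h (h0 ▸ SameRay.zero_right _)
  have hn1 : 0 < ‖e₁‖ := norm_pos_iff.2 h1
  have hn2 : 0 < ‖e₂‖ := norm_pos_iff.2 h2
  -- Equality in the Cauchy–Schwarz inequality would make the two edges leave in the same direction.
  have hcs : inner ℝ e₁ e₂ < ‖e₁‖ * ‖e₂‖ := by
    refine lt_of_le_of_ne (real_inner_le_norm _ _) fun heq => h ?_
    rw [inner_eq_norm_mul_iff_real] at heq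
    exact sameRay_iff_norm_smul_eq.2 heq.symm
  set n : Plane := ‖e₁‖⁻¹ • e₁ - ‖e₂‖⁻¹ • e₂ with hn
  have hl1 : 0 < inner ℝ n e₁ := by
    rw [hn, inner_sub_left, real_inner_smul_left, real_inner_smul_left, real_inner_self_eq_norm_sq,
      real_inner_comm]
    have : ‖e₂‖⁻¹ * inner ℝ e₁ e₂ < ‖e₂‖⁻¹ * (‖e₁‖ * ‖e₂‖) := by gcongr
    have e1 : ‖e₂‖⁻¹ * (‖e₁‖ * ‖e₂‖) = ‖e₁‖ := by field_simp
    have e2 : ‖e₁‖⁻¹ * ‖e₁‖ ^ 2 = ‖e₁‖ := by field_simp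
    linarith
  have hl2 : inner ℝ n e₂ < 0 := by
    rw [hn, inner_sub_left, real_inner_smul_left, real_inner_smul_left, real_inner_self_eq_norm_sq]
    have : ‖e₁‖⁻¹ * inner ℝ e₁ e₂ < ‖e₁‖⁻¹ * (‖e₁‖ * ‖e₂‖) := by gcongr
    have e1 : ‖e₁‖⁻¹ * (‖e₁‖ * ‖e₂‖) = ‖e₂‖ := by field_simp
    have e2 : ‖e₂‖⁻¹ * ‖e₂‖ ^ 2 = ‖e₂‖ := by field_simp
    linarith
  have hn0 : n ≠ 0 := by
    intro h0
    simp [h0] at hl1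
  have hnn : 0 < ‖n‖ := norm_pos_iff.2 hn0
  set a := inner ℝ n e₁
  obtain ⟨b, hb⟩ : ∃ b, b = - inner ℝ n e₂ := ⟨_, rfl⟩
  have hb0 : 0 < b := by linarith
  set M := ‖n‖ / a with hM
  set N := ‖n‖ / b with hN
  have hM0 : 0 < M := by positivity
  have hN0 : 0 < N := by positivity
  refine ⟨!₂[-n 1, n 0], ?_, (1 + M * ‖e₁‖ + N * ‖e₂‖) / ‖n‖, by positivity,
    min (1 / (2 * M)) (1 / N), by positivity, ?_⟩
  · intro h0
    apply hn0
    have h00 := congrArg (fun v : Plane => v 0) h0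
    have h01 := congrArg (fun v : Plane => v 1) h0
    simp at h00 h01
    ext i
    fin_cases i <;> simp [h00, h01]
  intro x s hs0 hs1 hd
  set r := dist x (A + s • e₁) with hr
  have hr0 : 0 ≤ r := dist_nonneg
  have hrM : M * r ≤ 1 / 2 := by
    have := hd.trans (min_le_left _ _)
    rw [le_div_iff₀ (by positivity)] at this
    linarith
  have hrN : N * r ≤ 1 := by
    have := hd.trans (min_le_right _ _)
    rw [le_div_iff₀ (by positivity)] at this
    linarith
  have hpr : ‖(x - A) - s • e₁‖ = r := by rw [hr, dist_eq_norm, sub_sub]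
  -- The linear functional `⟨n, ·⟩`, which is constant in the direction `ν`, differs by at most
  -- `‖n‖ * r` between `x` and the given point of the edge.
  have hlam : |inner ℝ n (x - A) - s * a| ≤ ‖n‖ * r := by
    have : inner ℝ n (x - A) - s * a = inner ℝ n ((x - A) - s • e₁) := by
      rw [inner_sub_right n (x - A), real_inner_smul_right]
    rw [this, ← hpr]
    exact abs_real_inner_le_norm _ _
  have hfin : ∀ (τ : ℝ) (e : Plane), 0 ≤ τ → τ ≤ 1 → (e = e₁ ∨ e = e₂) →
      inner ℝ n ((x - A) - τ • e) = 0 → ‖(x - A) - τ • e‖ ≤ (1 + M * ‖e₁‖ + N * ‖e₂‖) * r →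
      ∃ t : ℝ, |t| ≤ (1 + M * ‖e₁‖ + N * ‖e₂‖) / ‖n‖ * r ∧
        ∃ τ : ℝ, 0 ≤ τ ∧ τ ≤ 1 ∧ (x + t • (!₂[-n 1, n 0] : Plane) = A + τ • e₁ ∨
          x + t • (!₂[-n 1, n 0] : Plane) = A + τ • e₂) := by
    intro τ e hτ0 hτ1 he horth hle
    obtain ⟨t, ht, htn⟩ := exists_smul_quarterTurn_eq hn0 horth
    refine ⟨-t, ?_, τ, hτ0, hτ1, ?_⟩
    · rw [abs_neg, div_mul_eq_mul_div, le_div_iff₀ hnn, ← htn]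
      exact hle
    · have : x + (-t) • (!₂[-n 1, n 0] : Plane) = A + τ • e := by
        rw [neg_smul, ← ht]
        abel
      rcases he with rfl | rfl
      · exact Or.inl this
      · exact Or.inr this
  have hMr : ‖n‖ * r = M * r * a := by rw [hM]; field_simp
  have hNr : ‖n‖ * r = N * r * b := by rw [hN]; field_simp
  obtain ⟨hlo, hhi⟩ := abs_le.1 hlam
  -- The line through `x` meets the edge on its side of the line through `A`.
  rcases le_or_gt 0 (inner ℝ n (x - A)) with hpos | hneg
  · set τ := inner ℝ n (x - A) / a with hτ
    have hτa : inner ℝ n (x - A) = τ * a := by rw [hτ]; field_simp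
    have hτs : |τ - s| ≤ M * r := by
      rw [hMr, hτa] at hlo hhi
      rw [abs_le]
      constructor
      · refine le_of_mul_le_mul_right ?_ hl1
        linarith
      · refine le_of_mul_le_mul_right ?_ hl1
        linarith
    refine hfin τ e₁ (by positivity) ?_ (Or.inl rfl) ?_ ?_
    · linarith [(abs_le.1 hτs).2]
    · rw [inner_sub_right, real_inner_smul_right, hτa]
      exact sub_self _
    · have : (x - A) - τ • e₁ = ((x - A) - s • e₁) - (τ - s) • e₁ := by
        rw [sub_smul]; abel
      rw [this]
      refine (norm_sub_le _ _).trans ?_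
      rw [hpr, norm_smul, Real.norm_eq_abs]
      have : |τ - s| * ‖e₁‖ ≤ M * r * ‖e₁‖ := by gcongr
      have : 0 ≤ N * ‖e₂‖ * r := by positivity
      linarith
  · set τ := - inner ℝ n (x - A) / b with hτ
    have hτb : inner ℝ n (x - A) = - (τ * b) := by rw [hτ]; field_simp
    have hτ0 : 0 ≤ τ := div_nonneg (by linarith) hb0.le
    have hsa : 0 ≤ s * a := by positivity
    have hτr : τ ≤ N * r := by
      refine le_of_mul_le_mul_right ?_ hb0
      linarith
    have hsr : s ≤ M * r := by
      refine le_of_mul_le_mul_right ?_ hl1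
      linarith
    refine hfin τ e₂ hτ0 (hτr.trans hrN) (Or.inr rfl) ?_ ?_
    · rw [inner_sub_right, real_inner_smul_right, hτb, ← neg_eq_iff_eq_neg.2 hb]
      ring
    · have : (x - A) - τ • e₂ = ((x - A) - s • e₁) + s • e₁ - τ • e₂ := by abel
      rw [this]
      refine (norm_sub_le _ _).trans ((add_le_add_left (norm_add_le _ _) _).trans ?_)
      rw [hpr, norm_smul, norm_smul, Real.norm_eq_abs, Real.norm_eq_abs, abs_of_nonneg hs0,
        abs_of_nonneg hτ0]
      have : s * ‖e₁‖ ≤ M * r * ‖e₁‖ := by gcongr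
      have : τ * ‖e₂‖ ≤ N * r * ‖e₂‖ := by gcongr
      linarith

/-- Two segments which meet at most in end points do not leave a common end point in the same
direction. -/
lemma not_sameRay_of_inter_subset {A B Z : Plane} (hB : B ≠ A) (hZ : Z ≠ A)
    (h : affineSegment ℝ A B ∩ affineSegment ℝ A Z ⊆ {A, B}) : ¬ SameRay ℝ (B - A) (Z - A) := by
  intro hs
  obtain ⟨k, hk, hke⟩ := hs.exists_pos_left (sub_ne_zero.2 hB) (sub_ne_zero.2 hZ)
  set θ := min k 1 / 2 with hθ
  have hθ0 : 0 < θ := by positivity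
  have hθ1 : θ < 1 := by
    have := min_le_right k 1
    linarith
  have hθk : θ / k ≤ 1 := by
    have := min_le_left k 1
    rw [div_le_one hk]
    linarith
  have hmem : A + θ • (B - A) ∈ ({A, B} : Set Plane) := by
    refine h ⟨⟨θ, ⟨hθ0.le, hθ1.le⟩, ?_⟩, ⟨θ / k, ⟨by positivity, hθk⟩, ?_⟩⟩
    · rw [AffineMap.lineMap_apply, vsub_eq_sub, vadd_eq_add, add_comm]
    · rw [AffineMap.lineMap_apply, vsub_eq_sub, vadd_eq_add, add_comm, ← hke, smul_smul,
        div_mul_cancel₀ _ hk.ne']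
  rcases hmem with h0 | h0
  · rw [add_eq_left, smul_eq_zero] at h0
    exact h0.elim hθ0.ne' (sub_ne_zero.2 hB)
  · have h0 : A + θ • (B - A) = B := h0
    have : (1 - θ) • (B - A) = 0 := by
      rw [sub_smul, one_smul, sub_eq_zero, eq_comm, ← add_right_inj A, h0]
      abel
    rw [smul_eq_zero, sub_eq_zero, sub_eq_zero] at this
    exact this.elim hθ1.ne' hB

/-- The two edges of a simple polygon at a vertex `P i` leave it in different directions. -/
lemma IsSimplePolygon.not_sameRay {n : ℕ} {P : Polygon Plane n} (hP : IsSimplePolygon P)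
    (i : Fin n) :
    ¬ SameRay ℝ (P (finRotate n i) - P i) (P ((finRotate n).symm i) - P i) := by
  have hrot : ∀ j : Fin n, finRotate n j ≠ j := by
    obtain ⟨m, rfl⟩ : ∃ m, n = m + 2 := ⟨n - 2, by have := hP.three_le; omega⟩
    intro j hj
    rw [finRotate_apply] at hj
    simp at hj
  have hj : (finRotate n).symm i ≠ i := by
    intro h
    apply hrot i
    conv_lhs => rw [← h]
    exact Equiv.apply_symm_apply _ _
  refine not_sameRay_of_inter_subset (fun h => hrot i (hP.vertices_injective h))
    (fun h => hj (hP.vertices_injective h)) ?_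
  have := hP.edge_inter_subset i ((finRotate n).symm i) hj.symm
  simp only [Polygon.edgeSet, Equiv.apply_symm_apply] at this
  rw [affineSegment_comm ℝ (P ((finRotate n).symm i))] at this
  exact this.trans Set.inter_subset_left

lemma IsPolygonalDomain.isCompact_frontier {Ω : Set Plane} (hΩ : IsPolygonalDomain Ω) :
    IsCompact (frontier Ω) :=
  Metric.isCompact_of_isClosed_isBounded isClosed_frontier
    (hΩ.isBounded.closure.subset frontier_subset_closure)

lemma IsPolygonalDomain.frontier_nonempty {Ω : Set Plane} (hΩ : IsPolygonalDomain Ω) :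
    (frontier Ω).Nonempty := by
  obtain ⟨n, P, hP, hfr⟩ := hΩ.frontier_eq
  have i : Fin n := ⟨0, by have := hP.three_le; omega⟩
  rw [hfr]
  exact ⟨P i, Set.mem_iUnion.2 ⟨i, left_mem_affineSegment _ _ _⟩⟩

/-- In a polygonal domain the complement can be reached from every point `x` along one of finitely
many directions `ν` within a time that is at most a multiple of the distance of `x` to the
boundary. -/
lemma IsPolygonalDomain.exists_directions {Ω : Set Plane} (hΩ : IsPolygonalDomain Ω) :
    ∃ D : Finset Plane, (∀ ν ∈ D, ν ≠ 0) ∧ ∃ C : ℝ, 0 < C ∧ ∀ x ∈ Ω, ∃ ν ∈ D, ∃ t : ℝ, 0 ≤ t ∧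
      t ≤ C * Metric.infDist x (frontier Ω) ∧ x - t • ν ∉ Ω := by
  classical
  obtain ⟨n, P, hP, hfr⟩ := hΩ.frontier_eq
  have hn := hP.three_le
  have hne : Nonempty (Fin n) := ⟨⟨0, by omega⟩⟩
  have c1 := fun i => exists_direction_of_corner (A := P i) (hP.not_sameRay i)
  have c2 := fun i => exists_direction_of_corner (A := P i) fun h => hP.not_sameRay i h.symm
  choose ν₁ hν₁ C₁ hC₁ ε₁ hε₁ H₁ using c1
  choose ν₂ hν₂ C₂ hC₂ ε₂ hε₂ H₂ using c2
  obtain ⟨R, hR0, hR⟩ := hΩ.isBounded.exists_pos_norm_lt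
  obtain ⟨ε, hε, hεle⟩ : ∃ ε : ℝ, 0 < ε ∧ ∀ i, ε ≤ ε₁ i ∧ ε ≤ ε₂ i := by
    refine ⟨Finset.univ.inf' Finset.univ_nonempty fun i => min (ε₁ i) (ε₂ i), ?_, fun i => ?_⟩
    · rw [Finset.lt_inf'_iff]
      exact fun i _ => lt_min (hε₁ i) (hε₂ i)
    · have := Finset.inf'_le (fun i => min (ε₁ i) (ε₂ i)) (Finset.mem_univ i)
      exact ⟨this.trans (min_le_left _ _), this.trans (min_le_right _ _)⟩
  have i0 : Fin n := hne.some
  have hν0 : 0 < ‖ν₁ i0‖ := norm_pos_iff.2 (hν₁ i0)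
  set K := 2 * R / ‖ν₁ i0‖ / ε with hK
  have hK0 : 0 < K := by positivity
  set C := K + ∑ i, (C₁ i + C₂ i) with hC
  have hCle : ∀ i, C₁ i ≤ C ∧ C₂ i ≤ C := by
    intro i
    have : C₁ i + C₂ i ≤ ∑ i, (C₁ i + C₂ i) :=
      Finset.single_le_sum (f := fun i => C₁ i + C₂ i)
        (fun j _ => (add_pos (hC₁ j) (hC₂ j)).le) (Finset.mem_univ i)
    have := hC₁ i
    have := hC₂ i
    constructor <;> linarith
  have hKC : K ≤ C := by
    have : 0 ≤ ∑ i, (C₁ i + C₂ i) :=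
      Finset.sum_nonneg fun j _ => (add_pos (hC₁ j) (hC₂ j)).le
    linarith
  set D : Finset Plane := Finset.univ.image ν₁ ∪ Finset.univ.image ν₂ with hD
  refine ⟨D ∪ D.image (fun v => -v), ?_, C, hK0.trans_le hKC, ?_⟩
  · have hD0 : ∀ ν ∈ D, ν ≠ 0 := by
      intro ν hν
      rcases Finset.mem_union.1 hν with hν | hν <;> obtain ⟨i, -, rfl⟩ := Finset.mem_image.1 hν
      · exact hν₁ i
      · exact hν₂ i
    intro ν hν
    rcases Finset.mem_union.1 hν with hν | hν
    · exact hD0 ν hν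
    · obtain ⟨v, hv, rfl⟩ := Finset.mem_image.1 hν
      exact neg_ne_zero.2 (hD0 v hv)
  intro x hx
  suffices H : ∃ ν ∈ D, ∃ t : ℝ, |t| ≤ C * Metric.infDist x (frontier Ω) ∧ x + t • ν ∉ Ω by
    obtain ⟨ν, hν, t, ht, hxt⟩ := H
    rcases le_total 0 t with h0 | h0
    · refine ⟨-ν, Finset.mem_union_right _ (Finset.mem_image_of_mem _ hν), t, h0,
        (le_abs_self t).trans ht, ?_⟩
      rwa [smul_neg, sub_neg_eq_add]
    · refine ⟨ν, Finset.mem_union_left _ hν, -t, neg_nonneg.2 h0, (neg_le_abs t).trans ht, ?_⟩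
      rwa [neg_smul, sub_neg_eq_add]
  -- Far from the boundary any direction does, since `Ω` is bounded; the constant `K` serves these
  -- points.
  rcases le_or_gt ε (Metric.infDist x (frontier Ω)) with hfar | hnear
  · refine ⟨ν₁ i0, Finset.mem_union_left _ (Finset.mem_image_of_mem _ (Finset.mem_univ _)),
      2 * R / ‖ν₁ i0‖, ?_, ?_⟩
    · rw [abs_of_pos (by positivity)]
      calc 2 * R / ‖ν₁ i0‖ = K * ε := by rw [hK]; field_simp
        _ ≤ C * Metric.infDist x (frontier Ω) :=
          mul_le_mul hKC hfar hε.le (hK0.le.trans hKC)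
    · intro hmem
      have h1 := hR _ hmem
      have h2 := hR _ hx
      have h3 : ‖(2 * R / ‖ν₁ i0‖) • ν₁ i0‖ = 2 * R := by
        rw [norm_smul, Real.norm_of_nonneg (by positivity)]
        field_simp
      have h4 := norm_sub_le (x + (2 * R / ‖ν₁ i0‖) • ν₁ i0) x
      rw [add_sub_cancel_left, h3] at h4
      linarith
  obtain ⟨y, hy, hxy⟩ := hΩ.isCompact_frontier.exists_infDist_eq_dist hΩ.frontier_nonempty x
  have hnot : ∀ z, (∃ i, z ∈ P.edgeSet ℝ i) → z ∉ Ω := by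
    intro z hz hzΩ
    have : z ∈ frontier Ω := by rw [hfr]; exact Set.mem_iUnion.2 hz
    rw [hΩ.isOpen.frontier_eq] at this
    exact this.2 hzΩ
  have hedge : ∀ (i : Fin n) (τ : ℝ), 0 ≤ τ → τ ≤ 1 →
      P i + τ • (P (finRotate n i) - P i) ∉ Ω ∧
      P i + τ • (P ((finRotate n).symm i) - P i) ∉ Ω := by
    intro i τ h0 h1
    constructor
    · refine hnot _ ⟨i, τ, ⟨h0, h1⟩, ?_⟩
      rw [AffineMap.lineMap_apply, vsub_eq_sub, vadd_eq_add, add_comm]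
    · refine hnot _ ⟨(finRotate n).symm i, ?_⟩
      rw [Polygon.edgeSet, Equiv.apply_symm_apply, affineSegment_comm]
      refine ⟨τ, ⟨h0, h1⟩, ?_⟩
      rw [AffineMap.lineMap_apply, vsub_eq_sub, vadd_eq_add, add_comm]
  rw [hfr] at hy
  obtain ⟨i, s, ⟨hs0, hs1⟩, rfl⟩ := Set.mem_iUnion.1 hy
  rw [AffineMap.lineMap_apply, vsub_eq_sub, vadd_eq_add, add_comm] at hxy
  have hd0 : 0 ≤ Metric.infDist x (frontier Ω) := Metric.infDist_nonneg
  -- The direction belongs to that end point of the edge which is closer to the nearest point.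
  rcases le_total s (1 / 2) with hs | hs
  · obtain ⟨t, ht, τ, hτ0, hτ1, hτ⟩ := H₁ i x s hs0 hs
      (by rw [← hxy]; exact hnear.le.trans (hεle i).1)
    refine ⟨ν₁ i, Finset.mem_union_left _ (Finset.mem_image_of_mem _ (Finset.mem_univ _)), t,
      ?_, ?_⟩
    · rw [← hxy] at ht
      exact ht.trans (mul_le_mul_of_nonneg_right (hCle i).1 hd0)
    · rcases hτ with h | h <;> rw [h]
      · exact (hedge i τ hτ0 hτ1).1
      · exact (hedge i τ hτ0 hτ1).2
  · set j := finRotate n i with hj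
    have hji : (finRotate n).symm j = i := by rw [hj, Equiv.symm_apply_apply]
    have hpt : P i + s • (P j - P i) = P j + (1 - s) • (P ((finRotate n).symm j) - P j) := by
      rw [hji, sub_smul, one_smul, smul_sub, smul_sub]
      abel
    rw [hpt] at hxy
    obtain ⟨t, ht, τ, hτ0, hτ1, hτ⟩ := H₂ j x (1 - s) (by linarith) (by linarith)
      (by rw [← hxy]; exact hnear.le.trans (hεle j).2)
    refine ⟨ν₂ j, Finset.mem_union_right _ (Finset.mem_image_of_mem _ (Finset.mem_univ _)), t,
      ?_, ?_⟩
    · rw [← hxy] at ht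
      exact ht.trans (mul_le_mul_of_nonneg_right (hCle j).2 hd0)
    · rcases hτ with h | h <;> rw [h]
      · exact (hedge j τ hτ0 hτ1).2
      · exact (hedge j τ hτ0 hτ1).1

/-! ### Test functions -/

lemma gradient_eq_zero_of_notMem_tsupport {w : Plane → ℝ} {x : Plane} (hx : x ∉ tsupport w) :
    gradient w x = 0 := by
  have : fderiv ℝ w x = 0 := by
    by_contra h
    exact hx (support_fderiv_subset ℝ h)
  simp [gradient, this]

lemma IsTestFunction.continuous_gradient {Ω : Set Plane} {φ : Plane → ℝ}
    (hφ : IsTestFunction Ω φ) : Continuous (gradient φ) :=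
  (LinearIsometryEquiv.continuous _).comp (hφ.contDiff.continuous_fderiv (by simp))

lemma IsTestFunction.hasCompactSupport_gradient {Ω : Set Plane} {φ : Plane → ℝ}
    (hφ : IsTestFunction Ω φ) : HasCompactSupport (gradient φ) :=
  (hφ.hasCompactSupport.fderiv ℝ).mono fun x hx h0 => hx (by simp [gradient, h0])

/-! ### Hardy's inequality in one direction -/

/-- The time at which the half-line from `x` with velocity `-ν` leaves `Ω`. -/
noncomputable def exitTime (Ω : Set Plane) (ν x : Plane) : ℝ :=
  sInf {s : ℝ | 0 ≤ s ∧ x - s • ν ∉ Ω}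

lemma exitTime_le {Ω : Set Plane} {ν x : Plane} {s : ℝ} (hs : 0 ≤ s) (h : x - s • ν ∉ Ω) :
    exitTime Ω ν x ≤ s :=
  csInf_le ⟨0, fun _ h => h.1⟩ ⟨hs, h⟩

lemma exitTime_nonneg (Ω : Set Plane) (ν x : Plane) : 0 ≤ exitTime Ω ν x :=
  Real.sInf_nonneg fun _ h => h.1

lemma exitTime_spec {Ω : Set Plane} (ho : IsOpen Ω) (hb : Bornology.IsBounded Ω) {ν : Plane}
    (hν : ν ≠ 0) (x : Plane) : x - exitTime Ω ν x • ν ∉ Ω := by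
  have hcl : IsClosed {s : ℝ | 0 ≤ s ∧ x - s • ν ∉ Ω} := by
    refine isClosed_Ici.inter (IsClosed.preimage (f := fun s : ℝ => x - s • ν) (by fun_prop)
      ho.isClosed_compl)
  have hne : {s : ℝ | 0 ≤ s ∧ x - s • ν ∉ Ω}.Nonempty := by
    obtain ⟨R, hR0, hR⟩ := hb.exists_pos_norm_lt
    have hν0 : 0 < ‖ν‖ := norm_pos_iff.2 hν
    refine ⟨(‖x‖ + R) / ‖ν‖, by positivity, fun hmem => ?_⟩
    have h1 := hR _ hmem
    have h2 : ‖((‖x‖ + R) / ‖ν‖) • ν‖ = ‖x‖ + R := by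
      rw [norm_smul, Real.norm_of_nonneg (by positivity)]
      field_simp
    have h3 := norm_sub_norm_le (((‖x‖ + R) / ‖ν‖) • ν) x
    rw [norm_sub_rev] at h3
    linarith
  exact (hcl.csInf_mem hne ⟨0, fun _ h => h.1⟩).2

lemma le_exitTime_mul_norm {Ω : Set Plane} (ho : IsOpen Ω) (hb : Bornology.IsBounded Ω) {ν : Plane}
    (hν : ν ≠ 0) {x : Plane} {r : ℝ} (hr : Metric.ball x r ⊆ Ω) : r ≤ exitTime Ω ν x * ‖ν‖ := by
  by_contra! h
  refine exitTime_spec ho hb hν x (hr ?_)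
  rw [Metric.mem_ball, dist_eq_norm, sub_sub_cancel_left, norm_neg, norm_smul,
    Real.norm_of_nonneg (exitTime_nonneg _ _ _)]
  exact h

lemma exitTime_add_smul {Ω : Set Plane} (ho : IsOpen Ω) (hb : Bornology.IsBounded Ω) {ν : Plane}
    (hν : ν ≠ 0) {x : Plane} {h : ℝ} (hh : 0 ≤ h) (hx : ∀ s, 0 ≤ s → s ≤ h → x + s • ν ∈ Ω) :
    exitTime Ω ν (x + h • ν) = exitTime Ω ν x + h := by
  apply le_antisymm
  · refine exitTime_le (add_nonneg (exitTime_nonneg _ _ _) hh) ?_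
    have : x + h • ν - (exitTime Ω ν x + h) • ν = x - exitTime Ω ν x • ν := by
      rw [add_smul]; abel
    rw [this]
    exact exitTime_spec ho hb hν x
  · set s := exitTime Ω ν (x + h • ν) with hs
    have hs0 : 0 ≤ s := exitTime_nonneg _ _ _
    have hsp : x + h • ν - s • ν ∉ Ω := exitTime_spec ho hb hν _
    have hsh : h < s := by
      by_contra! hle
      apply hsp
      rw [add_sub_assoc, ← sub_smul]
      exact hx _ (by linarith) (by linarith)
    have : exitTime Ω ν x ≤ s - h := by
      refine exitTime_le (by linarith) ?_
      convert hsp using 2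
      rw [sub_smul]; abel
    linarith

lemma hasLineDerivAt_exitTime {Ω : Set Plane} (ho : IsOpen Ω) (hb : Bornology.IsBounded Ω)
    {ν : Plane} (hν : ν ≠ 0) {x : Plane} (hx : x ∈ Ω) :
    HasLineDerivAt ℝ (exitTime Ω ν) 1 x ν := by
  have hcont : ContinuousAt (fun t : ℝ => x + t • ν) 0 := by fun_prop
  have hmem : ∀ᶠ t in 𝓝 (0 : ℝ), x + t • ν ∈ Ω :=
    hcont.eventually (by simpa using ho.mem_nhds hx)
  obtain ⟨ε, hε, hball⟩ := Metric.eventually_nhds_iff.1 hmem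
  have heq : (fun t : ℝ => exitTime Ω ν (x + t • ν)) =ᶠ[𝓝 0] fun t => exitTime Ω ν x + t := by
    filter_upwards [Metric.ball_mem_nhds (0 : ℝ) hε] with t ht
    rw [Metric.mem_ball, Real.dist_eq, sub_zero, abs_lt] at ht
    rcases le_total 0 t with h0 | h0
    · refine exitTime_add_smul ho hb hν h0 fun s hs0 hs => hball ?_
      rw [Real.dist_eq, sub_zero, abs_lt]
      constructor <;> linarith
    · have := exitTime_add_smul ho hb hν (x := x + t • ν) (h := -t) (by linarith) fun s hs0 hs => ?_
      · rw [neg_smul, add_neg_cancel_right] at this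
        linarith
      · rw [add_assoc, ← add_smul]
        refine hball ?_
        rw [Real.dist_eq, sub_zero, abs_lt]
        constructor <;> linarith
  rw [HasLineDerivAt]
  exact ((hasDerivAt_id (0 : ℝ)).const_add _).congr_of_eventuallyEq heq

open Pointwise in
lemma measurable_exitTime {Ω : Set Plane} (ho : IsOpen Ω) (hb : Bornology.IsBounded Ω) {ν : Plane}
    (hν : ν ≠ 0) : Measurable (exitTime Ω ν) := by
  refine measurable_of_Iic fun r => IsClosed.measurableSet ?_
  have : exitTime Ω ν ⁻¹' Set.Iic r = Ωᶜ + (fun s : ℝ => s • ν) '' Set.Icc 0 r := by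
    ext x
    constructor
    · intro hx
      refine Set.mem_add.2 ⟨x - exitTime Ω ν x • ν, exitTime_spec ho hb hν x, _,
        ⟨exitTime Ω ν x, ⟨exitTime_nonneg _ _ _, hx⟩, rfl⟩, by simp⟩
    · intro hx
      obtain ⟨y, hy, _, ⟨s, hs, rfl⟩, rfl⟩ := Set.mem_add.1 hx
      exact (exitTime_le hs.1 (by simpa using hy)).trans hs.2
  rw [this]
  exact ho.isClosed_compl.add_right_of_isCompact (isCompact_Icc.image (by fun_prop))

lemma integrable_mul_of_bound_on_tsupport {φ g : Plane → ℝ} (hφ : Continuous φ)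
    (hc : HasCompactSupport φ) (hg : AEStronglyMeasurable g volume) {M : ℝ}
    (hM : ∀ x ∈ tsupport φ, |g x| ≤ M) : Integrable (fun x => φ x * g x) := by
  have hint : Integrable (fun x => ‖φ x‖ * M) :=
    (hφ.integrable_of_hasCompactSupport hc).norm.mul_const M
  refine hint.mono' (hφ.aestronglyMeasurable.mul hg) (Eventually.of_forall fun x => ?_)
  by_cases hx : x ∈ tsupport φ
  · rw [norm_mul]
    exact mul_le_mul_of_nonneg_left (hM x hx) (norm_nonneg _)
  · simp [image_eq_zero_of_notMem_tsupport hx]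

lemma IsCompact.exists_ball_subset {Ω K : Set Plane} (ho : IsOpen Ω) (hK : IsCompact K)
    (h : K ⊆ Ω) : ∃ r : ℝ, 0 < r ∧ ∀ x ∈ K, Metric.ball x r ⊆ Ω := by
  obtain ⟨r, hr, hsub⟩ := hK.exists_thickening_subset_open ho h
  exact ⟨r, hr, fun x hx => (Metric.ball_subset_thickening hx r).trans hsub⟩

lemma IsTestFunction.hasLineDerivAt_sq_mul_inv_exitTime {Ω : Set Plane} (ho : IsOpen Ω)
    (hb : Bornology.IsBounded Ω) {ν : Plane} (hν : ν ≠ 0) {φ : Plane → ℝ} (hφ : IsTestFunction Ω φ)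
    (x : Plane) :
    HasLineDerivAt ℝ (fun x => φ x ^ 2 * (exitTime Ω ν x)⁻¹)
      (2 * (φ x * fderiv ℝ φ x ν * (exitTime Ω ν x)⁻¹) - φ x ^ 2 * (exitTime Ω ν x ^ 2)⁻¹) x ν := by
  by_cases hx : x ∈ tsupport φ
  · have h1 : HasDerivAt (fun t : ℝ => φ (x + t • ν)) (fderiv ℝ φ x ν) 0 :=
      ((hφ.contDiff.differentiable (by simp)) x).hasFDerivAt.hasLineDerivAt ν
    have h2 : HasDerivAt (fun t : ℝ => exitTime Ω ν (x + t • ν)) 1 0 :=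
      hasLineDerivAt_exitTime ho hb hν (hφ.tsupport_subset hx)
    have hx0 : exitTime Ω ν x ≠ 0 := fun h0 => by
      have := exitTime_spec ho hb hν x
      rw [h0, zero_smul, sub_zero] at this
      exact this (hφ.tsupport_subset hx)
    have h3 := (h1.pow 2).mul (h2.inv (by simpa using hx0))
    refine h3.congr_deriv ?_
    simp only [zero_smul, add_zero, Pi.inv_apply, Pi.pow_apply]
    field_simp
    norm_num
    ring
  · have hF0 : 2 * (φ x * fderiv ℝ φ x ν * (exitTime Ω ν x)⁻¹)
        - φ x ^ 2 * (exitTime Ω ν x ^ 2)⁻¹ = 0 := by simp [image_eq_zero_of_notMem_tsupport hx]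
    rw [hF0]
    have heq : (fun x => φ x ^ 2 * (exitTime Ω ν x)⁻¹) =ᶠ[𝓝 x] fun _ => 0 := by
      filter_upwards [(isClosed_tsupport φ).isOpen_compl.mem_nhds hx] with y hy
      simp [image_eq_zero_of_notMem_tsupport hy]
    have : HasFDerivAt (fun x => φ x ^ 2 * (exitTime Ω ν x)⁻¹) (0 : Plane →L[ℝ] ℝ) x :=
      (hasFDerivAt_const (0 : ℝ) x).congr_of_eventuallyEq heq
    exact this.hasLineDerivAt ν

lemma integral_eq_zero_of_hasLineDerivAt {f f' : Plane → ℝ} {ν : Plane} (hf : Integrable f)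
    (hf' : Integrable f') (h : ∀ x, HasLineDerivAt ℝ f (f' x) x ν) : ∫ x, f' x = 0 := by
  have := integral_bilinear_hasLineDerivAt_right_eq_neg_left_of_integrable (μ := volume) (v := ν)
    (f := fun _ : Plane => (1 : ℝ)) (f' := fun _ => 0) (g := f) (g' := f')
    (B := ContinuousLinearMap.mul ℝ ℝ) (by simp) (by simpa using hf') (by simpa using hf)
    (fun x _ => (hasFDerivAt_const (1 : ℝ) x).hasLineDerivAt ν) (fun x _ => h x)
  simpa using this

/-- The one-dimensional Hardy inequality along the lines with direction `ν`. Inside `Ω` the exit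
time grows along these lines with speed one, so that `φ² / exitTime` has the derivative
`2 φ ∂φ / exitTime - φ² / exitTime²`, whose integral vanishes. -/
lemma IsTestFunction.hardy_exitTime {Ω : Set Plane} (ho : IsOpen Ω) (hb : Bornology.IsBounded Ω)
    {ν : Plane} (hν : ν ≠ 0) {φ : Plane → ℝ} (hφ : IsTestFunction Ω φ) :
    Integrable (fun x => φ x ^ 2 * (exitTime Ω ν x ^ 2)⁻¹) ∧
    ∫ x, φ x ^ 2 * (exitTime Ω ν x ^ 2)⁻¹ ≤ 4 * ∫ x, (fderiv ℝ φ x ν) ^ 2 := by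
  have hcont : Continuous φ := hφ.contDiff.continuous
  have hdcont : Continuous (fun x => fderiv ℝ φ x ν) :=
    (hφ.contDiff.continuous_fderiv (by simp)).clm_apply continuous_const
  have hdc : HasCompactSupport (fun x => fderiv ℝ φ x ν) := hφ.hasCompactSupport.fderiv_apply ℝ ν
  set ρ := exitTime Ω ν with hρ
  have hmeas : Measurable ρ := measurable_exitTime ho hb hν
  have hν0 : 0 < ‖ν‖ := norm_pos_iff.2 hν
  obtain ⟨r, hr, hball⟩ :=
    IsCompact.exists_ball_subset ho hφ.hasCompactSupport.isCompact hφ.tsupport_subset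
  have hlow : ∀ x ∈ tsupport φ, r / ‖ν‖ ≤ ρ x := fun x hx => by
    rw [div_le_iff₀ hν0]
    exact le_exitTime_mul_norm ho hb hν (hball x hx)
  have hrν : 0 < r / ‖ν‖ := by positivity
  have hsq : HasCompactSupport (fun x => φ x ^ 2) :=
    hφ.hasCompactSupport.mono fun x hx h0 => hx (by simp [h0])
  have hsub : tsupport (fun x => φ x ^ 2) ⊆ tsupport φ :=
    closure_mono fun x hx h0 => hx (by simp [h0])
  have hsub' : tsupport (fun x => φ x * fderiv ℝ φ x ν) ⊆ tsupport φ :=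
    tsupport_mul_subset_left
  have hb1 : ∀ x ∈ tsupport φ, |(ρ x)⁻¹| ≤ (r / ‖ν‖)⁻¹ := fun x hx => by
    rw [abs_of_nonneg (inv_nonneg.2 (exitTime_nonneg _ _ _))]
    exact inv_anti₀ hrν (hlow x hx)
  have hb2 : ∀ x ∈ tsupport φ, |(ρ x ^ 2)⁻¹| ≤ ((r / ‖ν‖) ^ 2)⁻¹ := fun x hx => by
    rw [abs_of_nonneg (inv_nonneg.2 (sq_nonneg _))]
    exact inv_anti₀ (by positivity) (pow_le_pow_left₀ hrν.le (hlow x hx) 2)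
  have i1 : Integrable (fun x => φ x ^ 2 * (ρ x)⁻¹) :=
    integrable_mul_of_bound_on_tsupport (hcont.pow 2) hsq hmeas.inv.aestronglyMeasurable
      fun x hx => hb1 x (hsub hx)
  have i2 : Integrable (fun x => φ x ^ 2 * (ρ x ^ 2)⁻¹) :=
    integrable_mul_of_bound_on_tsupport (hcont.pow 2) hsq
      (hmeas.pow_const 2).inv.aestronglyMeasurable fun x hx => hb2 x (hsub hx)
  have i3 : Integrable (fun x => φ x * fderiv ℝ φ x ν * (ρ x)⁻¹) :=
    integrable_mul_of_bound_on_tsupport (hcont.mul hdcont) hφ.hasCompactSupport.mul_right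
      hmeas.inv.aestronglyMeasurable fun x hx => hb1 x (hsub' hx)
  have i4 : Integrable (fun x => (fderiv ℝ φ x ν) ^ 2) :=
    (hdcont.pow 2).integrable_of_hasCompactSupport (hdc.mono fun x hx h0 => hx (by simp [h0]))
  refine ⟨i2, ?_⟩
  have hzero := integral_eq_zero_of_hasLineDerivAt i1 ((i3.const_mul 2).sub i2)
    (hφ.hasLineDerivAt_sq_mul_inv_exitTime ho hb hν)
  rw [integral_sub' (i3.const_mul 2) i2, integral_const_mul] at hzero
  have hineq : ∫ x, φ x * fderiv ℝ φ x ν * (ρ x)⁻¹ ≤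
      ∫ x, (1 / 4 * (φ x ^ 2 * (ρ x ^ 2)⁻¹) + (fderiv ℝ φ x ν) ^ 2) := by
    refine integral_mono i3 ((i2.const_mul _).add i4) fun x => ?_
    have := sq_nonneg (1 / 2 * (φ x * (ρ x)⁻¹) - fderiv ℝ φ x ν)
    simp only [← inv_pow]
    linarith
  rw [integral_add (i2.const_mul _) i4, integral_const_mul] at hineq
  linarith

/-- Hardy's inequality in a polygonal domain. At every point the distance to the boundary, and hence
`σ`, controls one of finitely many exit times, so that the directional inequalities add up. -/
lemma IsPolygonalDomain.exists_hardy {Ω : Set Plane} (hΩ : IsPolygonalDomain Ω) :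
    ∃ C : ℝ, 0 < C ∧ ∀ d : ℝ, 0 < d → ∀ φ : Plane → ℝ, IsTestFunction Ω φ →
      ∫ x in Ω, ((regDist Ω d x)⁻¹) ^ 2 * φ x ^ 2 ≤ C * ∫ x in Ω, ‖gradient φ x‖ ^ 2 := by
  obtain ⟨D, hD0, C, hC, hD⟩ := hΩ.exists_directions
  refine ⟨C ^ 2 * ∑ ν ∈ D, 4 * ‖ν‖ ^ 2 + 1, by positivity, ?_⟩
  intro d hd φ hφ
  have hg0 : ∀ x ∉ Ω, gradient φ x = 0 := fun x hx =>
    gradient_eq_zero_of_notMem_tsupport fun h => hx (hφ.tsupport_subset h)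
  have hφ0 : ∀ x ∉ Ω, φ x = 0 := fun x hx =>
    image_eq_zero_of_notMem_tsupport fun h => hx (hφ.tsupport_subset h)
  rw [setIntegral_eq_integral_of_forall_compl_eq_zero (fun x hx => by simp [hφ0 x hx]),
    setIntegral_eq_integral_of_forall_compl_eq_zero (fun x hx => by simp [hg0 x hx])]
  have hgint : Integrable fun x => ‖gradient φ x‖ ^ 2 := by
    refine (hφ.continuous_gradient.norm.pow 2).integrable_of_hasCompactSupport ?_
    exact hφ.hasCompactSupport_gradient.mono fun x hx h0 => hx (by simp [h0])
  have hpt : ∀ x, ((regDist Ω d x)⁻¹) ^ 2 * φ x ^ 2 ≤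
      C ^ 2 * ∑ ν ∈ D, φ x ^ 2 * (exitTime Ω ν x ^ 2)⁻¹ := by
    intro x
    have hnn : ∀ ν ∈ D, 0 ≤ φ x ^ 2 * (exitTime Ω ν x ^ 2)⁻¹ := fun ν _ => by positivity
    by_cases hx : x ∈ Ω
    · obtain ⟨ν, hν, t, ht0, ht, hxt⟩ := hD x hx
      have he : exitTime Ω ν x ≤ C * regDist Ω d x := by
        refine (exitTime_le ht0 hxt).trans (ht.trans (mul_le_mul_of_nonneg_left ?_ hC.le))
        rw [regDist]
        linarith
      have he0 : 0 < exitTime Ω ν x := by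
        refine lt_of_le_of_ne (exitTime_nonneg _ _ _) fun h0 => ?_
        have := exitTime_spec hΩ.isOpen hΩ.isBounded (hD0 ν hν) x
        rw [← h0, zero_smul, sub_zero] at this
        exact this hx
      have hinv : (regDist Ω d x)⁻¹ ≤ C * (exitTime Ω ν x)⁻¹ := by
        have hσ : 0 < regDist Ω d x := pos_of_mul_pos_right (he0.trans_le he) hC.le
        rw [inv_eq_one_div, div_le_iff₀ hσ, mul_right_comm, ← div_eq_mul_inv, one_le_div he0]
        exact he
      have hσ0 : 0 ≤ (regDist Ω d x)⁻¹ := by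
        have : 0 ≤ Metric.infDist x (frontier Ω) := Metric.infDist_nonneg
        rw [regDist]
        positivity
      calc ((regDist Ω d x)⁻¹) ^ 2 * φ x ^ 2 ≤ (C * (exitTime Ω ν x)⁻¹) ^ 2 * φ x ^ 2 := by gcongr
        _ = C ^ 2 * (φ x ^ 2 * (exitTime Ω ν x ^ 2)⁻¹) := by rw [mul_pow, inv_pow]; ring
        _ ≤ _ := by
          gcongr
          exact Finset.single_le_sum (f := fun ν => φ x ^ 2 * (exitTime Ω ν x ^ 2)⁻¹) hnn hν
    · simp [hφ0 x hx]
  have hint : ∀ ν ∈ D, Integrable fun x => φ x ^ 2 * (exitTime Ω ν x ^ 2)⁻¹ := fun ν hν =>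
    (hφ.hardy_exitTime hΩ.isOpen hΩ.isBounded (hD0 ν hν)).1
  have hgnn : 0 ≤ ∫ x, ‖gradient φ x‖ ^ 2 := integral_nonneg fun x => by positivity
  calc ∫ x, ((regDist Ω d x)⁻¹) ^ 2 * φ x ^ 2
      ≤ ∫ x, C ^ 2 * ∑ ν ∈ D, φ x ^ 2 * (exitTime Ω ν x ^ 2)⁻¹ :=
        integral_mono_of_nonneg (Eventually.of_forall fun x => by positivity)
          ((integrable_finsetSum _ hint).const_mul _) (Eventually.of_forall hpt)
    _ = C ^ 2 * ∑ ν ∈ D, ∫ x, φ x ^ 2 * (exitTime Ω ν x ^ 2)⁻¹ := by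
        rw [integral_const_mul, integral_finsetSum _ hint]
    _ ≤ C ^ 2 * ∑ ν ∈ D, 4 * ‖ν‖ ^ 2 * ∫ x, ‖gradient φ x‖ ^ 2 := by
        gcongr with ν hν
        refine (hφ.hardy_exitTime hΩ.isOpen hΩ.isBounded (hD0 ν hν)).2.trans ?_
        rw [mul_assoc, ← integral_const_mul (‖ν‖ ^ 2)]
        refine mul_le_mul_of_nonneg_left ?_ (by norm_num)
        refine integral_mono_of_nonneg (Eventually.of_forall fun x => by positivity)
          (hgint.const_mul _) (Eventually.of_forall fun x => ?_)
        have h1 : fderiv ℝ φ x ν = inner ℝ (gradient φ x) ν := by simp [gradient]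
        show (fderiv ℝ φ x ν) ^ 2 ≤ ‖ν‖ ^ 2 * ‖gradient φ x‖ ^ 2
        rw [h1, ← sq_abs, ← mul_pow, mul_comm]
        exact pow_le_pow_left₀ (abs_nonneg _) (abs_real_inner_le_norm _ _) 2
    _ ≤ _ := by
        rw [← Finset.sum_mul]
        linarith

/-! ### Gradients of Lipschitz functions -/

lemma LipschitzWith.norm_gradient_le {C : NNReal} {w : Plane → ℝ} (hw : LipschitzWith C w)
    (x : Plane) : ‖gradient w x‖ ≤ C := by
  rw [gradient, LinearIsometryEquiv.norm_map]
  exact norm_fderiv_le_of_lipschitz ℝ hw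

lemma measurable_gradient (w : Plane → ℝ) : Measurable (gradient w) :=
  (LinearIsometryEquiv.continuous _).measurable.comp (measurable_fderiv ℝ w)

lemma lineDeriv_eq_inner_gradient {w : Plane → ℝ} {x : Plane}
    (hw : DifferentiableAt ℝ w x) (v : Plane) : lineDeriv ℝ w x v = inner ℝ (gradient w x) v := by
  rw [hw.lineDeriv_eq_fderiv, inner_gradient_left]

/-- A bounded measurable function which vanishes off a compact set is integrable. -/
lemma integrable_of_bound_of_isCompact {F : Type*} [NormedAddCommGroup F] {g : Plane → F}
    {K : Set Plane} (hK : IsCompact K)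
    (hg : AEStronglyMeasurable g volume) {M : ℝ} (hM : ∀ x, ‖g x‖ ≤ M) (h0 : ∀ x ∉ K, g x = 0) :
    Integrable g := by
  have hsupp : Function.support g ⊆ K := fun x hx => by
    by_contra h
    exact hx (h0 x h)
  rw [← integrableOn_iff_integrable_of_support_subset hsupp]
  exact Measure.integrableOn_of_bounded hK.measure_lt_top.ne hg (Eventually.of_forall hM)

lemma integrable_inner_gradient {C D : NNReal} {w g : Plane → ℝ} (hw : LipschitzWith C w)
    (hc : HasCompactSupport w) (hg : LipschitzWith D g) :
    Integrable fun x => inner ℝ (gradient w x) (gradient g x) := by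
  refine integrable_of_bound_of_isCompact (K := tsupport w) (M := C * D) hc.isCompact
    ((measurable_gradient w).inner (measurable_gradient g)).aestronglyMeasurable (fun x => ?_)
    (fun x hx => by rw [gradient_eq_zero_of_notMem_tsupport hx, inner_zero_left])
  refine (norm_inner_le_norm _ _).trans ?_
  exact mul_le_mul (hw.norm_gradient_le x) (hg.norm_gradient_le x) (norm_nonneg _) C.coe_nonneg

/-- The product of two Lipschitz functions is Lipschitz if the first one is bounded and the second
one is bounded on the support of the first. -/
lemma lipschitzWith_mul_of_bound_on_tsupport {C D M N : NNReal} {f g : Plane → ℝ}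
    (hf : LipschitzWith C f) (hg : LipschitzWith D g) (hM : ∀ x, |f x| ≤ M)
    (hN : ∀ x ∈ tsupport f, |g x| ≤ N) : LipschitzWith (N * C + M * D) fun x => f x * g x := by
  have key : ∀ x y, x ∈ tsupport f →
      |f x * g x - f y * g y| ≤ (N * C + M * D) * dist x y := by
    intro x y hx
    have h1 : |f x - f y| ≤ C * dist x y := by simpa [Real.dist_eq] using hf.dist_le_mul x y
    have h2 : |g x - g y| ≤ D * dist x y := by simpa [Real.dist_eq] using hg.dist_le_mul x y
    calc |f x * g x - f y * g y| = |g x * (f x - f y) + f y * (g x - g y)| := by ring_nf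
      _ ≤ |g x| * |f x - f y| + |f y| * |g x - g y| := by
        rw [← abs_mul, ← abs_mul]; exact abs_add_le _ _
      _ ≤ N * (C * dist x y) + M * (D * dist x y) := by
        gcongr
        · exact hN x hx
        · exact hM y
      _ = _ := by ring
  refine LipschitzWith.of_dist_le_mul fun x y => ?_
  rw [Real.dist_eq]
  push_cast
  by_cases hx : x ∈ tsupport f
  · exact key x y hx
  by_cases hy : y ∈ tsupport f
  · rw [abs_sub_comm, dist_comm]
    exact key y x hy
  · rw [image_eq_zero_of_notMem_tsupport hx, image_eq_zero_of_notMem_tsupport hy]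
    simp only [zero_mul, sub_zero, abs_zero]
    positivity

/-! ### The distance to the boundary of a convex domain -/

lemma lipschitzWith_regDist (Ω : Set Plane) (d : ℝ) : LipschitzWith 1 (regDist Ω d) := by
  refine LipschitzWith.of_dist_le_mul fun x y => ?_
  have := (Metric.lipschitz_infDist_pt (frontier Ω)).dist_le_mul x y
  simpa [regDist, Real.dist_eq] using this

lemma le_regDist (Ω : Set Plane) (d : ℝ) (x : Plane) : d ≤ regDist Ω d x := by
  have : 0 ≤ Metric.infDist x (frontier Ω) := Metric.infDist_nonneg
  rw [regDist]
  linarith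

lemma ball_infDist_frontier_subset {Ω : Set Plane} (ho : IsOpen Ω) {x : Plane} (hx : x ∈ Ω) :
    Metric.ball x (Metric.infDist x (frontier Ω)) ⊆ Ω := by
  rcases le_or_gt (Metric.infDist x (frontier Ω)) 0 with h | h
  · rw [Metric.ball_eq_empty.2 h]
    exact Set.empty_subset _
  refine (convex_ball x _).isPreconnected.subset_left_of_subset_union (v := (closure Ω)ᶜ) ho
    isClosed_closure.isOpen_compl ?_ ?_ ⟨x, Metric.mem_ball_self h, hx⟩
  · exact (disjoint_compl_right).mono_left subset_closure
  · intro y hy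
    have hyf : y ∉ frontier Ω := fun hyf =>
      (Metric.disjoint_ball_infDist.ne_of_mem hy hyf) rfl
    rw [ho.frontier_eq] at hyf
    by_cases hyc : y ∈ closure Ω
    · by_contra hcon
      exact hyf ⟨hyc, fun h => hcon (Or.inl h)⟩
    · exact Or.inr hyc

/-- In a convex domain the distance to the boundary is midpoint concave: with two balls the domain
also contains the ball whose centre and radius are the averages. -/
lemma regDist_add_regDist_le {Ω : Set Plane} (ho : IsOpen Ω) (hconv : Convex ℝ Ω)
    (hne : (frontier Ω).Nonempty) (d : ℝ) {x v : Plane} (h1 : x + v ∈ Ω) (h2 : x - v ∈ Ω) :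
    regDist Ω d (x + v) + regDist Ω d (x - v) ≤ 2 * regDist Ω d x := by
  set a := Metric.infDist (x + v) (frontier Ω) with ha
  set b := Metric.infDist (x - v) (frontier Ω) with hb
  have ha0 : 0 ≤ a := Metric.infDist_nonneg
  have hb0 : 0 ≤ b := Metric.infDist_nonneg
  suffices H : (a + b) / 2 ≤ Metric.infDist x (frontier Ω) by
    simp only [regDist]
    linarith
  rw [Metric.le_infDist hne]
  intro y hy
  by_contra! hlt
  have hab : 0 < a + b := by
    have := dist_nonneg (x := x) (y := y)
    linarith
  have hyΩ : y ∈ Ω := by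
    set c := 2 / (a + b) with hc
    have hc0 : 0 < c := by positivity
    have hcy : c * ‖y - x‖ < 1 := by
      rw [← dist_eq_norm, dist_comm, hc, div_mul_eq_mul_div, div_lt_one hab]
      linarith
    have hshift : ∀ p ∈ Ω, p + (c * Metric.infDist p (frontier Ω)) • (y - x) ∈ Ω := by
      intro p hp
      rcases Metric.infDist_nonneg (x := p) (s := frontier Ω) |>.eq_or_lt with h0 | hpos
      · rwa [← h0, mul_zero, zero_smul, add_zero]
      · refine ball_infDist_frontier_subset ho hp ?_
        rw [Metric.mem_ball, dist_eq_norm, add_sub_cancel_left, norm_smul,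
          Real.norm_of_nonneg (by positivity), mul_right_comm]
        exact mul_lt_of_lt_one_left hpos hcy
    have hmid := hconv (hshift _ h1) (hshift _ h2) (by norm_num : (0 : ℝ) ≤ 1 / 2)
      (by norm_num : (0 : ℝ) ≤ 1 / 2) (by norm_num)
    convert hmid using 1
    have hsum : 1 / 2 * (c * a) + 1 / 2 * (c * b) = 1 := by
      rw [hc]
      field_simp
    have : y - x = (1 / 2 * (c * a) + 1 / 2 * (c * b)) • (y - x) := by rw [hsum, one_smul]
    have e : y = x + (y - x) := by abel
    conv_lhs => rw [e, this]
    rw [← ha, ← hb]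
    module
  rw [ho.frontier_eq] at hy
  exact hy.2 hyΩ

/-- The distance to the boundary decreases with unit speed towards a nearest boundary point. -/
lemma norm_gradient_regDist {Ω : Set Plane} (ho : IsOpen Ω) (hcpt : IsCompact (frontier Ω))
    (hne : (frontier Ω).Nonempty) {d : ℝ} {x : Plane} (hx : x ∈ Ω)
    (hd : DifferentiableAt ℝ (regDist Ω d) x) : ‖gradient (regDist Ω d) x‖ = 1 := by
  refine le_antisymm ((lipschitzWith_regDist Ω d).norm_gradient_le x) ?_
  obtain ⟨y, hy, hxy⟩ := hcpt.exists_infDist_eq_dist hne x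
  have hyx : 0 < dist x y := by
    rw [dist_pos]
    rintro rfl
    rw [ho.frontier_eq] at hy
    exact hy.2 hx
  have h1 : HasDerivAt (fun t : ℝ => regDist Ω d (x + t • (y - x)))
      (inner ℝ (gradient (regDist Ω d) x) (y - x)) 0 := by
    rw [inner_gradient_left]
    exact hd.hasFDerivAt.hasLineDerivAt (y - x)
  have heq : ∀ t ∈ Set.Icc (0 : ℝ) 1,
      regDist Ω d (x + t • (y - x)) = d + (1 - t) * dist x y := by
    intro t ht
    rw [regDist]
    congr 1
    have e1 : dist (x + t • (y - x)) y = (1 - t) * dist x y := by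
      have : x + t • (y - x) - y = (1 - t) • (x - y) := by module
      rw [dist_eq_norm, this, norm_smul, Real.norm_of_nonneg (by linarith [ht.2]), dist_eq_norm]
    have e2 : dist (x + t • (y - x)) x = t * dist x y := by
      rw [dist_eq_norm, add_sub_cancel_left, norm_smul, Real.norm_of_nonneg ht.1, dist_comm,
        dist_eq_norm]
    apply le_antisymm
    · rw [← e1]
      exact Metric.infDist_le_dist_of_mem hy
    · have := Metric.infDist_le_infDist_add_dist (s := frontier Ω) (x := x) (y := x + t • (y - x))
      rw [hxy, dist_comm x (x + _), e2] at this
      linarith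
  have h2 : HasDerivWithinAt (fun t : ℝ => regDist Ω d (x + t • (y - x)))
      (-dist x y) (Set.Icc 0 1) 0 := by
    have : HasDerivAt (fun t : ℝ => d + (1 - t) * dist x y) (-dist x y) 0 := by
      have := (((hasDerivAt_id (0 : ℝ)).const_sub 1).mul_const (dist x y)).const_add d
      simpa using this
    exact this.hasDerivWithinAt.congr heq (heq 0 ⟨le_rfl, zero_le_one⟩)
  have h3 := (uniqueDiffOn_Icc (zero_lt_one (α := ℝ)) 0 ⟨le_rfl, zero_le_one⟩).eq_deriv _
    h1.hasDerivWithinAt h2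
  have h4 := neg_le_of_abs_le (abs_real_inner_le_norm (gradient (regDist Ω d) x) (y - x))
  rw [h3, ← dist_eq_norm, dist_comm y x] at h4
  exact le_of_mul_le_mul_right (by linarith) hyx

/-- One direction of the superharmonicity of the distance to the boundary of a convex domain:
summation by parts turns the product of difference quotients into a second difference of the
distance, which is concave. -/
lemma integral_lineDeriv_regDist_mul_nonneg {Ω : Set Plane} (ho : IsOpen Ω) (hconv : Convex ℝ Ω)
    (hne : (frontier Ω).Nonempty) (d : ℝ) {C : NNReal} {w : Plane → ℝ} (hw : LipschitzWith C w)
    (hc : HasCompactSupport w) (hsub : tsupport w ⊆ Ω) (h0 : ∀ x, 0 ≤ w x) (v : Plane) :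
    0 ≤ ∫ x, lineDeriv ℝ (regDist Ω d) x v * lineDeriv ℝ w x v := by
  set σ := regDist Ω d with hσ
  have hσL : LipschitzWith 1 σ := lipschitzWith_regDist Ω d
  set K := Metric.cthickening ‖v‖ (tsupport w) with hK
  have hKc : IsCompact K := IsCompact.cthickening hc
  have hlim : Tendsto
      (fun t : ℝ => ∫ x, (t⁻¹ • (σ (x + t • v) - σ x)) * (t⁻¹ • (w (x + t • v) - w x)))
      (𝓝[>] 0) (𝓝 (∫ x, lineDeriv ℝ σ x v * lineDeriv ℝ w x v)) := by
    have hquot : ∀ (D : NNReal) (g : Plane → ℝ), LipschitzWith D g → ∀ t : ℝ, 0 < t → ∀ x,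
        |t⁻¹ • (g (x + t • v) - g x)| ≤ D * ‖v‖ := by
      intro D g hg t ht x
      have := hg.norm_sub_le (x + t • v) x
      rw [add_sub_cancel_left, norm_smul, Real.norm_of_nonneg ht.le, Real.norm_eq_abs] at this
      rw [smul_eq_mul, abs_mul, abs_of_pos (inv_pos.2 ht), inv_mul_le_iff₀ ht]
      linarith
    refine tendsto_integral_filter_of_dominated_convergence
      (K.indicator fun _ => (1 : NNReal) * ‖v‖ * (C * ‖v‖)) (Eventually.of_forall fun t => ?_)
      ?_ ?_ ?_
    · have := hσL.continuous
      have := hw.continuous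
      exact Continuous.aestronglyMeasurable (by fun_prop)
    · filter_upwards [Ioc_mem_nhdsGT zero_lt_one] with t ht
      refine Eventually.of_forall fun x => ?_
      by_cases hx : x ∈ K
      · rw [Set.indicator_of_mem hx, norm_mul]
        exact mul_le_mul (hquot 1 σ hσL t ht.1 x) (hquot C w hw t ht.1 x) (norm_nonneg _)
          (by positivity)
      · have A : w x = 0 := by
          refine image_eq_zero_of_notMem_tsupport fun h => hx ?_
          exact Metric.self_subset_cthickening _ h
        have B : w (x + t • v) = 0 := by
          refine image_eq_zero_of_notMem_tsupport fun h => hx ?_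
          refine Metric.mem_cthickening_of_dist_le _ _ ‖v‖ (tsupport w) h ?_
          rw [dist_eq_norm, sub_add_cancel_left, norm_neg, norm_smul, Real.norm_of_nonneg ht.1.le]
          exact mul_le_of_le_one_left (norm_nonneg v) ht.2
        rw [A, B, Set.indicator_of_notMem hx]
        simp
    · rw [integrable_indicator_iff hKc.measurableSet]
      exact integrableOn_const hKc.measure_lt_top.ne
    · filter_upwards [hσL.ae_lineDifferentiableAt v, hw.ae_lineDifferentiableAt v] with x h1 h2
      exact h1.hasLineDerivAt.tendsto_slope_zero_right.mul
        h2.hasLineDerivAt.tendsto_slope_zero_right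
  refine ge_of_tendsto hlim ?_
  -- For small `t` the points `x ± t • v` with `x` in the support of `w` remain in `Ω`.
  obtain ⟨r, hr, hball⟩ := IsCompact.exists_ball_subset ho hc.isCompact hsub
  have hr' : 0 < r / (‖v‖ + 1) := by positivity
  filter_upwards [Ioo_mem_nhdsGT hr'] with t ht
  have htv : ‖t • v‖ < r := by
    rw [norm_smul, Real.norm_of_nonneg ht.1.le]
    have := ht.2
    rw [lt_div_iff₀ (by positivity)] at this
    have := ht.1
    linarith
  have hcσ := hσL.continuous
  have hcw := hw.continuous
  have i0 : ∀ g : Plane → ℝ, Continuous g → Integrable fun x => g x * w x := fun g hg =>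
    (hg.mul hcw).integrable_of_hasCompactSupport hc.mul_left
  have i1 : Integrable fun x => (σ (x + t • v) - σ x) * w x := i0 _ (by fun_prop)
  have i2 : Integrable fun x => (σ x - σ (x - t • v)) * w x := i0 _ (by fun_prop)
  have i3 : Integrable fun x => (σ (x + t • v) - σ x) * w (x + t • v) := by
    have := i2.comp_add_right (t • v)
    simpa using this
  have e3 : ∫ x, (σ (x + t • v) - σ x) * w (x + t • v) = ∫ x, (σ x - σ (x - t • v)) * w x := by
    rw [← integral_add_right_eq_self (fun x => (σ x - σ (x - t • v)) * w x) (t • v)]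
    simp
  have key : ∫ x, (t⁻¹ • (σ (x + t • v) - σ x)) * (t⁻¹ • (w (x + t • v) - w x)) =
      t⁻¹ ^ 2 * ∫ x, (2 * σ x - (σ (x + t • v) + σ (x - t • v))) * w x := by
    calc _ = ∫ x, t⁻¹ ^ 2 * ((σ (x + t • v) - σ x) * w (x + t • v) -
            (σ (x + t • v) - σ x) * w x) := by
          congr 1; ext x; simp only [smul_eq_mul]; ring
      _ = t⁻¹ ^ 2 * ((∫ x, (σ x - σ (x - t • v)) * w x) - ∫ x, (σ (x + t • v) - σ x) * w x) := by
          rw [integral_const_mul, integral_sub i3 i1, e3]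
      _ = _ := by
          rw [← integral_sub i2 i1]
          congr 2; ext x; ring
  rw [key]
  refine mul_nonneg (by positivity) (integral_nonneg fun x => ?_)
  show 0 ≤ (2 * σ x - (σ (x + t • v) + σ (x - t • v))) * w x
  by_cases hx : x ∈ tsupport w
  · refine mul_nonneg (sub_nonneg.2 (regDist_add_regDist_le ho hconv hne d (hball x hx ?_)
      (hball x hx ?_))) (h0 x)
    · simpa [dist_eq_norm] using htv
    · simpa [dist_eq_norm] using htv
  · rw [image_eq_zero_of_notMem_tsupport hx, mul_zero]

/-- The distance to the boundary of a convex domain is superharmonic. -/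
lemma integral_inner_gradient_regDist_nonneg {Ω : Set Plane} (ho : IsOpen Ω) (hconv : Convex ℝ Ω)
    (hne : (frontier Ω).Nonempty) (d : ℝ) {C : NNReal} {w : Plane → ℝ} (hw : LipschitzWith C w)
    (hc : HasCompactSupport w) (hsub : tsupport w ⊆ Ω) (h0 : ∀ x, 0 ≤ w x) :
    0 ≤ ∫ x, inner ℝ (gradient w x) (gradient (regDist Ω d) x) := by
  have hσL := lipschitzWith_regDist Ω d
  let b := EuclideanSpace.basisFun (Fin 2) ℝ
  have heq : ∫ x, inner ℝ (gradient w x) (gradient (regDist Ω d) x) =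
      ∫ x, ∑ i, lineDeriv ℝ (regDist Ω d) x (b i) * lineDeriv ℝ w x (b i) := by
    refine integral_congr_ae ?_
    filter_upwards [hσL.ae_differentiableAt, hw.ae_differentiableAt] with x h1 h2
    rw [← b.sum_inner_mul_inner]
    refine Finset.sum_congr rfl fun i _ => ?_
    rw [lineDeriv_eq_inner_gradient h1, lineDeriv_eq_inner_gradient h2,
      real_inner_comm (gradient (regDist Ω d) x), mul_comm]
  rw [heq, integral_finsetSum]
  · exact Finset.sum_nonneg fun i _ =>
      integral_lineDeriv_regDist_mul_nonneg ho hconv hne d hw hc hsub h0 (b i)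
  · intro i _
    refine integrable_of_bound_of_isCompact (K := tsupport w)
      (M := (1 : NNReal) * ‖b i‖ * (C * ‖b i‖)) hc.isCompact ?_ (fun x => ?_) fun x hx => ?_
    · exact ((measurable_lineDeriv hσL.continuous).mul
        (measurable_lineDeriv hw.continuous)).aestronglyMeasurable
    · rw [norm_mul]
      exact mul_le_mul (norm_lineDeriv_le_of_lipschitz ℝ hσL) (norm_lineDeriv_le_of_lipschitz ℝ hw)
        (norm_nonneg _) (by positivity)
    · have heq : w =ᶠ[𝓝 x] fun _ => 0 := by
        filter_upwards [(isClosed_tsupport w).isOpen_compl.mem_nhds hx] with y hy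
        exact image_eq_zero_of_notMem_tsupport hy
      rw [heq.lineDeriv_eq]
      simp [lineDeriv]

/-! ### The logarithmic Hardy inequality in a convex domain -/

lemma lipschitzWith_log_regDist (Ω : Set Plane) {d : ℝ} (hd : 0 < d) :
    LipschitzWith (Real.toNNReal d⁻¹) fun x => Real.log (regDist Ω d x) := by
  have key : ∀ x y, Real.log (regDist Ω d x) - Real.log (regDist Ω d y) ≤ d⁻¹ * dist x y := by
    intro x y
    have hx := hd.trans_le (le_regDist Ω d x)
    have hy := hd.trans_le (le_regDist Ω d y)
    have h1 : regDist Ω d x - regDist Ω d y ≤ dist x y := by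
      have := (lipschitzWith_regDist Ω d).dist_le_mul x y
      rw [Real.dist_eq, NNReal.coe_one, one_mul] at this
      exact (le_abs_self _).trans this
    rw [← Real.log_div hx.ne' hy.ne']
    refine (Real.log_le_sub_one_of_pos (by positivity)).trans ?_
    have : regDist Ω d x / regDist Ω d y - 1 =
        (regDist Ω d y)⁻¹ * (regDist Ω d x - regDist Ω d y) := by field_simp
    rw [this]
    refine (mul_le_mul_of_nonneg_left h1 (by positivity)).trans ?_
    exact mul_le_mul_of_nonneg_right (inv_anti₀ hd (le_regDist Ω d y)) dist_nonneg
  refine LipschitzWith.of_dist_le_mul fun x y => ?_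
  rw [Real.dist_eq, Real.coe_toNNReal _ (by positivity), abs_le]
  have h1 := key x y
  have h2 := key y x
  rw [dist_comm y x] at h2
  constructor <;> linarith

lemma IsTestFunction.exists_lipschitzWith_mul {Ω : Set Plane} {φ g : Plane → ℝ}
    (hφ : IsTestFunction Ω φ) {D N : NNReal} (hg : LipschitzWith D g)
    (hN : ∀ x ∈ Ω, |g x| ≤ N) : ∃ C, LipschitzWith C fun x => φ x * g x := by
  obtain ⟨C, hC⟩ := hφ.contDiff.lipschitzWith_of_hasCompactSupport hφ.hasCompactSupport (by simp)
  obtain ⟨M, hM⟩ := hφ.contDiff.continuous.bounded_above_of_compact_support hφ.hasCompactSupport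
  refine ⟨_, lipschitzWith_mul_of_bound_on_tsupport (M := M.toNNReal) hC hg (fun x => ?_)
    fun x hx => hN x (hφ.tsupport_subset hx)⟩
  exact (hM x).trans (Real.le_coe_toNNReal M)

lemma IsTestFunction.mul_self {Ω : Set Plane} {φ : Plane → ℝ} (hφ : IsTestFunction Ω φ) :
    IsTestFunction Ω fun x => φ x * φ x where
  contDiff := hφ.contDiff.mul hφ.contDiff
  hasCompactSupport := hφ.hasCompactSupport.mul_right
  tsupport_subset := tsupport_mul_subset_left.trans hφ.tsupport_subset

lemma IsTestFunction.gradient_mul_self {Ω : Set Plane} {φ : Plane → ℝ} (hφ : IsTestFunction Ω φ)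
    (x : Plane) : gradient (fun x => φ x * φ x) x = (2 * φ x) • gradient φ x := by
  have h := (hφ.contDiff.differentiable (by simp)) x
  refine ext_inner_right ℝ fun v => ?_
  rw [inner_gradient_left, real_inner_smul_left, inner_gradient_left, fderiv_fun_mul h h]
  simp
  ring

/-- Hardy's inequality with the weight `σ` in a convex domain, where it holds with the square of a
logarithm as the constant: the superharmonic function `σ` is tested with `φ² log (S / σ)`. -/
lemma IsTestFunction.weighted_hardy {Ω : Set Plane} (ho : IsOpen Ω) (hconv : Convex ℝ Ω)
    (hcpt : IsCompact (frontier Ω)) (hne : (frontier Ω).Nonempty) {d S : ℝ} (hd : 0 < d)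
    (hdS : d ≤ S) (hS : ∀ x ∈ Ω, regDist Ω d x ≤ S) {φ : Plane → ℝ} (hφ : IsTestFunction Ω φ) :
    ∫ x in Ω, (regDist Ω d x)⁻¹ * φ x ^ 2 ≤
      4 * Real.log (S / d) ^ 2 * ∫ x in Ω, regDist Ω d x * ‖gradient φ x‖ ^ 2 := by
  set σ := regDist Ω d with hσ
  set L := Real.log (S / d) with hL
  have hσL : LipschitzWith 1 σ := lipschitzWith_regDist Ω d
  have hσ0 : ∀ x, 0 < σ x := fun x => hd.trans_le (le_regDist Ω d x)
  have hS0 : 0 < S := hd.trans_le hdS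
  have hL0 : 0 ≤ L := Real.log_nonneg ((one_le_div hd).2 hdS)
  have hψ : ∀ x ∈ Ω, 0 ≤ Real.log S - Real.log (σ x) ∧ Real.log S - Real.log (σ x) ≤ L := by
    intro x hx
    have h1 := Real.log_le_log (hσ0 x) (hS x hx)
    have h2 := Real.log_le_log hd (le_regDist Ω d x)
    rw [hL, Real.log_div hS0.ne' hd.ne']
    constructor <;> linarith
  have hφ0 : ∀ x ∉ Ω, φ x = 0 := fun x hx =>
    image_eq_zero_of_notMem_tsupport fun h => hx (hφ.tsupport_subset h)
  have hg0 : ∀ x ∉ Ω, gradient φ x = 0 := fun x hx =>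
    gradient_eq_zero_of_notMem_tsupport fun h => hx (hφ.tsupport_subset h)
  set w : Plane → ℝ := fun x => φ x * φ x * (Real.log S - Real.log (σ x)) with hw
  obtain ⟨C, hC⟩ : ∃ C, LipschitzWith C w := by
    refine hφ.mul_self.exists_lipschitzWith_mul (N := L.toNNReal)
      ((LipschitzWith.const (Real.log S)).sub (lipschitzWith_log_regDist Ω hd)) fun x hx => ?_
    rw [Real.coe_toNNReal _ hL0, abs_of_nonneg (hψ x hx).1]
    exact (hψ x hx).2
  have hwsub : tsupport w ⊆ tsupport φ :=
    tsupport_mul_subset_left.trans tsupport_mul_subset_left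
  have hwc : HasCompactSupport w := hφ.mul_self.hasCompactSupport.mul_right
  have hwnn : ∀ x, 0 ≤ w x := by
    intro x
    by_cases hx : x ∈ Ω
    · exact mul_nonneg (mul_self_nonneg _) (hψ x hx).1
    · simp [hw, hφ0 x hx]
  have hsuper := integral_inner_gradient_regDist_nonneg ho hconv hne d hC hwc
    (hwsub.trans hφ.tsupport_subset) hwnn
  have hφcont := hφ.contDiff.continuous
  have hgcont := hφ.continuous_gradient
  have i1 : Integrable fun x => (σ x)⁻¹ * φ x ^ 2 := by
    refine Continuous.integrable_of_hasCompactSupport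
      ((hσL.continuous.inv₀ fun x => (hσ0 x).ne').mul (hφcont.pow 2)) ?_
    exact hφ.hasCompactSupport.mono fun x hx h0 => hx (by simp [h0])
  have i2 : Integrable fun x => σ x * ‖gradient φ x‖ ^ 2 := by
    refine Continuous.integrable_of_hasCompactSupport (hσL.continuous.mul (hgcont.norm.pow 2)) ?_
    exact hφ.hasCompactSupport_gradient.mono fun x hx h0 => hx (by simp [h0])
  have hineq : ∫ x, inner ℝ (gradient w x) (gradient σ x) ≤
      ∫ x, (2 * L ^ 2 * (σ x * ‖gradient φ x‖ ^ 2) - 1 / 2 * ((σ x)⁻¹ * φ x ^ 2)) := by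
    refine integral_mono_ae (integrable_inner_gradient hC hwc hσL)
      ((i2.const_mul _).sub (i1.const_mul _)) ?_
    filter_upwards [hσL.ae_differentiableAt, hC.ae_differentiableAt] with x h1 h2
    by_cases hx : x ∈ Ω
    · have hn : ‖gradient σ x‖ = 1 := norm_gradient_regDist ho hcpt hne hx h1
      set v := gradient σ x with hv
      have e1 : HasDerivAt (fun t : ℝ => φ (x + t • v)) (inner ℝ (gradient φ x) v) 0 := by
        rw [inner_gradient_left]
        exact ((hφ.contDiff.differentiable (by simp)) x).hasFDerivAt.hasLineDerivAt v
      have e2 : HasDerivAt (fun t : ℝ => σ (x + t • v)) 1 0 := by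
        have : fderiv ℝ σ x v = 1 := by
          rw [← inner_gradient_left, ← hv, real_inner_self_eq_norm_sq, hn, one_pow]
        rw [← this]
        exact h1.hasFDerivAt.hasLineDerivAt v
      have e3 : HasLineDerivAt ℝ w
          (2 * φ x * inner ℝ (gradient φ x) v * (Real.log S - Real.log (σ x)) -
            φ x ^ 2 * (σ x)⁻¹) x v := by
        have := (e1.mul e1).mul ((e2.log (by simpa using (hσ0 x).ne')).const_sub (Real.log S))
        refine this.congr_deriv ?_
        simp only [zero_smul, add_zero, Pi.mul_apply]
        ring
      rw [← lineDeriv_eq_inner_gradient h2, e3.lineDeriv]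
      have hpos := hσ0 x
      have hin : |inner ℝ (gradient φ x) v| ≤ ‖gradient φ x‖ := by
        have := abs_real_inner_le_norm (gradient φ x) v
        rwa [hn, mul_one] at this
      have hcross : φ x * inner ℝ (gradient φ x) v * (Real.log S - Real.log (σ x)) ≤
          |φ x| * ‖gradient φ x‖ * L := by
        refine (le_abs_self _).trans ?_
        rw [abs_mul, abs_mul, abs_of_nonneg (hψ x hx).1]
        have := (hψ x hx).2
        gcongr
        exact (hψ x hx).1
      -- Young's inequality; half of the term with `φ x ^ 2` is absorbed by the left-hand side.
      have hyoung : 2 * (|φ x| * ‖gradient φ x‖ * L) ≤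
          2 * L ^ 2 * (σ x * ‖gradient φ x‖ ^ 2) + 1 / 2 * ((σ x)⁻¹ * φ x ^ 2) := by
        have hsq : 0 ≤ (2 * σ x * (L * ‖gradient φ x‖) - |φ x|) ^ 2 * (2 * σ x)⁻¹ := by positivity
        have : (2 * σ x * (L * ‖gradient φ x‖) - |φ x|) ^ 2 * (2 * σ x)⁻¹ =
            2 * L ^ 2 * (σ x * ‖gradient φ x‖ ^ 2) + 1 / 2 * ((σ x)⁻¹ * φ x ^ 2)
              - 2 * (|φ x| * ‖gradient φ x‖ * L) := by
          rw [← sq_abs (φ x)]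
          field_simp
          ring
        linarith
      have : 2 * φ x * inner ℝ (gradient φ x) v * (Real.log S - Real.log (σ x)) =
        2 * (φ x * inner ℝ (gradient φ x) v * (Real.log S - Real.log (σ x))) := by ring
      rw [this, mul_comm (φ x ^ 2)]
      linarith
    · have : gradient w x = 0 :=
        gradient_eq_zero_of_notMem_tsupport fun h => hx (hφ.tsupport_subset (hwsub h))
      simp [this, hφ0 x hx, hg0 x hx]
  rw [integral_sub (i2.const_mul _) (i1.const_mul _), integral_const_mul,
    integral_const_mul] at hineq
  rw [setIntegral_eq_integral_of_forall_compl_eq_zero (fun x hx => by simp [hφ0 x hx]),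
    setIntegral_eq_integral_of_forall_compl_eq_zero (fun x hx => by simp [hg0 x hx])]
  linarith

/-! ### Lipschitz functions as test functions -/

lemma IsTestFunction.memH10 {Ω : Set Plane} {φ : Plane → ℝ} (hφ : IsTestFunction Ω φ) :
    MemH10 Ω φ (gradient φ) where
  memLp := (hφ.contDiff.continuous.memLp_of_hasCompactSupport hφ.hasCompactSupport).restrict _
  memLp_grad := (hφ.continuous_gradient.memLp_of_hasCompactSupport
    hφ.hasCompactSupport_gradient).restrict _
  exists_approx := ⟨fun _ => φ, fun _ => hφ, by simp, by simp⟩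

open Convolution in
/-- The gradient of a Lipschitz function may be taken before or after mollification. -/
lemma gradient_convolution_eq (η : ContDiffBump (0 : Plane)) {C : NNReal} {W : Plane → ℝ}
    (hW : LipschitzWith C W) (x : Plane) :
    gradient (η.normed volume ⋆[ContinuousLinearMap.lsmul ℝ ℝ, volume] W) x =
      (η.normed volume ⋆[ContinuousLinearMap.lsmul ℝ ℝ, volume] gradient W) x := by
  set Wk := η.normed volume ⋆[ContinuousLinearMap.lsmul ℝ ℝ, volume] W with hWk
  have hsmooth : ContDiff ℝ 1 Wk :=
    η.hasCompactSupport_normed.contDiff_convolution_left _ η.contDiff_normed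
      hW.continuous.locallyIntegrable
  have hηi : Integrable (η.normed volume) :=
    η.continuous_normed.integrable_of_hasCompactSupport η.hasCompactSupport_normed
  refine ext_inner_right ℝ fun v => ?_
  have hdiff : DifferentiableAt ℝ Wk x := hsmooth.differentiable (by simp) x
  have hg : LipschitzWith C fun s => W (x - s) := by
    refine LipschitzWith.of_dist_le_mul fun a b => ?_
    have := hW.dist_le_mul (x - a) (x - b)
    rwa [dist_sub_left] at this
  have hconvint : ∀ y, Integrable fun s => η.normed volume s * W (y - s) := fun y =>
    (η.continuous_normed.mul (hW.continuous.comp (continuous_const.sub continuous_id))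
      ).integrable_of_hasCompactSupport η.hasCompactSupport_normed.mul_right
  have hlim1 : Tendsto (fun t : ℝ => t⁻¹ • (Wk (x + t • v) - Wk x)) (𝓝[>] 0)
      (𝓝 (inner ℝ (gradient Wk x) v)) := by
    rw [inner_gradient_left]
    exact (hdiff.hasFDerivAt.hasLineDerivAt v).tendsto_slope_zero_right
  have hlim2 := hg.integral_inv_smul_sub_mul_tendsto_integral_lineDeriv_mul hηi (-v)
  have heq : (fun t : ℝ => ∫ s, (t⁻¹ • (W (x - (s + t • -v)) - W (x - s))) * η.normed volume s) =
      fun t : ℝ => t⁻¹ • (Wk (x + t • v) - Wk x) := by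
    ext t
    simp only [hWk, convolution, ContinuousLinearMap.lsmul_apply, smul_eq_mul]
    rw [← integral_sub (hconvint _) (hconvint _), ← integral_const_mul]
    congr 1
    ext s
    have : x - (s + t • -v) = x + t • v - s := by module
    rw [this]
    ring
  rw [heq] at hlim2
  rw [tendsto_nhds_unique hlim1 hlim2, convolution]
  have hvec : Integrable fun s => η.normed volume s • gradient W (x - s) := by
    refine (hηi.norm.mul_const (C : ℝ)).mono' ?_ (Eventually.of_forall fun s => ?_)
    · exact (η.continuous_normed.measurable.smul
        ((measurable_gradient W).comp (measurable_const.sub measurable_id))).aestronglyMeasurable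
    · rw [norm_smul]
      exact mul_le_mul_of_nonneg_left (hW.norm_gradient_le _) (norm_nonneg _)
  simp only [ContinuousLinearMap.lsmul_apply]
  rw [real_inner_comm, ← integral_inner hvec]
  refine integral_congr_ae ?_
  have hae : ∀ᵐ s, DifferentiableAt ℝ W (x - s) :=
    (Measure.measurePreserving_sub_left volume x).quasiMeasurePreserving.ae hW.ae_differentiableAt
  filter_upwards [hae] with s hs
  rw [real_inner_smul_right, real_inner_comm, ← lineDeriv_eq_inner_gradient hs, mul_comm]
  congr 1
  simp only [lineDeriv]
  congr 1
  ext t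
  congr 1
  module

open Convolution in
/-- The weak formulation extends to Lipschitz functions with compact support, by mollification. -/
lemma IsWeakSolution.weak_form_of_lipschitz {Ω : Set Plane} (ho : IsOpen Ω)
    (hb : Bornology.IsBounded Ω) {f u : Plane → ℝ} {Du : Plane → Plane}
    (hf : MemLp f 2 (volume.restrict Ω)) (hu : IsWeakSolution Ω f u Du) {C : NNReal}
    {W : Plane → ℝ} (hW : LipschitzWith C W) (hc : HasCompactSupport W) (hsub : tsupport W ⊆ Ω) :
    ∫ x in Ω, inner ℝ (Du x) (gradient W x) = ∫ x in Ω, f x * W x := by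
  obtain ⟨r, hr, hrΩ⟩ := hc.isCompact.exists_cthickening_subset_open ho hsub
  let η : ℕ → ContDiffBump (0 : Plane) := fun k =>
    ⟨r / (2 * (k + 1)), r / (k + 1), by positivity, by
      have hk : (0 : ℝ) ≤ k := Nat.cast_nonneg k
      apply div_lt_div_of_pos_left hr <;> [positivity; linarith]⟩
  have hη : Tendsto (fun k => (η k).rOut) atTop (𝓝 0) :=
    tendsto_const_div_atTop_nhds_zero_nat r |>.comp (tendsto_add_atTop_nat 1) |>.congr
      fun k => by simp [η]
  have hηr : ∀ k, (η k).rOut ≤ r := fun k =>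
    div_le_self hr.le (by linarith [(Nat.cast_nonneg k : (0 : ℝ) ≤ k)])
  have hη2 : ∀ k, (η k).rOut ≤ 2 * (η k).rIn := fun k => by
    have : (0 : ℝ) < k + 1 := by positivity
    have e : r / ((k : ℝ) + 1) = 2 * (r / (2 * (k + 1))) := by field_simp
    exact e.le
  set Wk : ℕ → Plane → ℝ := fun k =>
    (η k).normed volume ⋆[ContinuousLinearMap.lsmul ℝ ℝ, volume] W with hWk
  have hsupp : ∀ k, tsupport (Wk k) ⊆ Metric.cthickening r (tsupport W) := by
    intro k
    refine closure_minimal (fun x hx => ?_) Metric.isClosed_cthickening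
    obtain ⟨y, hy, z, hz, rfl⟩ := Set.mem_add.1 (support_convolution_subset _ hx)
    rw [(η k).support_normed_eq, Metric.mem_ball, dist_zero_right] at hy
    refine Metric.mem_cthickening_of_dist_le _ z _ _ (subset_tsupport _ hz) ?_
    rw [dist_eq_norm, add_sub_cancel_right]
    exact hy.le.trans (hηr k)
  have htest : ∀ k, IsTestFunction Ω (Wk k) := fun k =>
    { contDiff := (η k).hasCompactSupport_normed.contDiff_convolution_left _
        (η k).contDiff_normed hW.continuous.locallyIntegrable
      hasCompactSupport :=
        hc.isCompact.cthickening.of_isClosed_subset (isClosed_tsupport _) (hsupp k)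
      tsupport_subset := (hsupp k).trans hrΩ }
  have hnorm : ∀ {F : Type} [NormedAddCommGroup F] [NormedSpace ℝ F] (g : Plane → F) (M : ℝ),
      (∀ x, ‖g x‖ ≤ M) → ∀ k x,
      ‖((η k).normed volume ⋆[ContinuousLinearMap.lsmul ℝ ℝ, volume] g) x‖ ≤ M := by
    intro F _ _ g M hM k x
    have hi : Integrable ((η k).normed volume) :=
      (η k).continuous_normed.integrable_of_hasCompactSupport (η k).hasCompactSupport_normed
    calc _ ≤ ∫ s, (η k).normed volume s * M := by
          refine norm_integral_le_of_norm_le (hi.mul_const M) (Eventually.of_forall fun s => ?_)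
          rw [ContinuousLinearMap.lsmul_apply, norm_smul,
            Real.norm_of_nonneg ((η k).nonneg_normed s)]
          exact mul_le_mul_of_nonneg_left (hM _) ((η k).nonneg_normed s)
      _ = M := by rw [integral_mul_const, (η k).integral_normed, one_mul]
  obtain ⟨M, hM⟩ := hW.continuous.bounded_above_of_compact_support hc
  have : IsFiniteMeasure (volume.restrict Ω) := ⟨by simpa using hb.measure_lt_top⟩
  have hfi : Integrable f (volume.restrict Ω) := hf.integrable (by norm_num)
  have hDi : Integrable Du (volume.restrict Ω) := hu.memH10.memLp_grad.integrable (by norm_num)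
  have hgloc : LocallyIntegrable (gradient W) volume :=
    (integrable_of_bound_of_isCompact hc.isCompact (measurable_gradient W).aestronglyMeasurable
      hW.norm_gradient_le fun x hx => gradient_eq_zero_of_notMem_tsupport hx).locallyIntegrable
  have hlim1 : Tendsto (fun k => ∫ x in Ω, inner ℝ (Du x) (gradient (Wk k) x)) atTop
      (𝓝 (∫ x in Ω, inner ℝ (Du x) (gradient W x))) := by
    refine tendsto_integral_of_dominated_convergence (fun x => ‖Du x‖ * C) (fun k => ?_)
      (hDi.norm.mul_const _) (fun k => Eventually.of_forall fun x => ?_) ?_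
    · exact hDi.aestronglyMeasurable.inner (htest k).continuous_gradient.aestronglyMeasurable
    · refine (norm_inner_le_norm _ _).trans (mul_le_mul_of_nonneg_left ?_ (norm_nonneg _))
      rw [gradient_convolution_eq (η k) hW]
      exact hnorm _ _ hW.norm_gradient_le k x
    · refine ae_restrict_of_ae ?_
      filter_upwards [ContDiffBump.ae_convolution_tendsto_right_of_locallyIntegrable hη
        (Eventually.of_forall hη2) hgloc] with x hx
      simp only [hWk, gradient_convolution_eq (η _) hW]
      exact tendsto_const_nhds.inner hx
  have hlim2 : Tendsto (fun k => ∫ x in Ω, f x * Wk k x) atTop (𝓝 (∫ x in Ω, f x * W x)) := by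
    refine tendsto_integral_of_dominated_convergence (fun x => ‖f x‖ * M) (fun k => ?_)
      (hfi.norm.mul_const _) (fun k => Eventually.of_forall fun x => ?_)
      (Eventually.of_forall fun x => ?_)
    · exact hfi.aestronglyMeasurable.mul (htest k).contDiff.continuous.aestronglyMeasurable
    · rw [norm_mul]
      exact mul_le_mul_of_nonneg_left (hnorm _ _ hM k x) (norm_nonneg _)
    · exact (ContDiffBump.convolution_tendsto_right_of_continuous hη hW.continuous x).const_mul _
  refine tendsto_nhds_unique hlim1 (hlim2.congr fun k => ?_)
  exact (hu.weak_form _ _ (htest k).memH10).symm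

/-! ### Limits in `L²` -/

lemma tendsto_eLpNorm_of_le_mul {α E F : Type*} [MeasurableSpace α] {μ : Measure α}
    [NormedAddCommGroup E] [NormedAddCommGroup F] {f : ℕ → α → F} {g : ℕ → α → E}
    {p : ℝ≥0∞} {M : ℝ}
    (h : ∀ k, ∀ᵐ x ∂μ, ‖g k x‖ ≤ M * ‖f k x‖)
    (hf : Tendsto (fun k => eLpNorm (f k) p μ) atTop (𝓝 0)) :
    Tendsto (fun k => eLpNorm (g k) p μ) atTop (𝓝 0) := by
  have hlim : Tendsto (fun k => ENNReal.ofReal M * eLpNorm (f k) p μ) atTop (𝓝 0) := by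
    have := ENNReal.Tendsto.const_mul hf (Or.inr (ENNReal.ofReal_ne_top (r := M)))
    rwa [mul_zero] at this
  exact tendsto_of_tendsto_of_tendsto_of_le_of_le tendsto_const_nhds hlim (fun _ => zero_le)
    fun k => eLpNorm_le_mul_eLpNorm_of_ae_le_mul (h k) p

section L2

variable {α E : Type*} [MeasurableSpace α] {μ : Measure α} [NormedAddCommGroup E]
  [InnerProductSpace ℝ E]

lemma integral_inner_eq_inner_toLp {f g : α → E} (hf : MemLp f 2 μ) (hg : MemLp g 2 μ) :
    ∫ x, inner ℝ (f x) (g x) ∂μ = inner ℝ (hf.toLp f) (hg.toLp g) := by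
  rw [L2.inner_def]
  refine integral_congr_ae ?_
  filter_upwards [hf.coeFn_toLp, hg.coeFn_toLp] with x h1 h2
  rw [h1, h2]

lemma integrable_inner_of_memLp {f g : α → E} (hf : MemLp f 2 μ) (hg : MemLp g 2 μ) :
    Integrable (fun x => inner ℝ (f x) (g x)) μ := by
  refine (L2.integrable_inner (𝕜 := ℝ) (hf.toLp f) (hg.toLp g)).congr ?_
  filter_upwards [hf.coeFn_toLp, hg.coeFn_toLp] with x h1 h2
  rw [h1, h2]

lemma integral_inner_le_eLpNorm_mul_eLpNorm {f g : α → E} (hf : MemLp f 2 μ) (hg : MemLp g 2 μ) :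
    ∫ x, inner ℝ (f x) (g x) ∂μ ≤ (eLpNorm f 2 μ).toReal * (eLpNorm g 2 μ).toReal := by
  rw [integral_inner_eq_inner_toLp hf hg]
  refine (real_inner_le_norm _ _).trans_eq ?_
  rw [Lp.norm_toLp, Lp.norm_toLp]

lemma toReal_eLpNorm_sq {f : α → E} (hf : MemLp f 2 μ) :
    (eLpNorm f 2 μ).toReal ^ 2 = ∫ x, ‖f x‖ ^ 2 ∂μ := by
  have h := integral_inner_eq_inner_toLp hf hf
  rw [real_inner_self_eq_norm_sq, Lp.norm_toLp] at h
  rw [← h]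
  simp only [real_inner_self_eq_norm_sq]

lemma tendsto_integral_inner {f g : α → E} {F G : ℕ → α → E} (hF : ∀ k, MemLp (F k) 2 μ)
    (hf : MemLp f 2 μ) (hG : ∀ k, MemLp (G k) 2 μ) (hg : MemLp g 2 μ)
    (hFf : Tendsto (fun k => eLpNorm (fun x => F k x - f x) 2 μ) atTop (𝓝 0))
    (hGg : Tendsto (fun k => eLpNorm (fun x => G k x - g x) 2 μ) atTop (𝓝 0)) :
    Tendsto (fun k => ∫ x, inner ℝ (F k x) (G k x) ∂μ) atTop (𝓝 (∫ x, inner ℝ (f x) (g x) ∂μ)) := by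
  have h1 := (Lp.tendsto_Lp_iff_tendsto_eLpNorm'' F hF f hf).2 hFf
  have h2 := (Lp.tendsto_Lp_iff_tendsto_eLpNorm'' G hG g hg).2 hGg
  rw [integral_inner_eq_inner_toLp hf hg]
  refine (h1.inner h2).congr fun k => ?_
  rw [integral_inner_eq_inner_toLp (hF k) (hG k)]

lemma memLp_smul_of_bound {p : ℝ≥0∞} {a : α → ℝ} {f : α → E} {M : ℝ} (ha : AEStronglyMeasurable a μ)
    (hM : ∀ᵐ x ∂μ, |a x| ≤ M) (hf : MemLp f p μ) : MemLp (fun x => a x • f x) p μ := by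
  refine hf.of_le_mul (c := M) (ha.smul hf.aestronglyMeasurable) ?_
  filter_upwards [hM] with x hx
  rw [norm_smul]
  exact mul_le_mul_of_nonneg_right hx (norm_nonneg _)

/-- The convergence in `L²` of two factors is inherited by the integral of their inner product with
a bounded weight. -/
lemma tendsto_integral_mul_inner {f g : α → E} {F G : ℕ → α → E} {a : α → ℝ} {M : ℝ}
    (ha : AEStronglyMeasurable a μ) (hM : ∀ᵐ x ∂μ, |a x| ≤ M) (hF : ∀ k, MemLp (F k) 2 μ)
    (hf : MemLp f 2 μ) (hG : ∀ k, MemLp (G k) 2 μ) (hg : MemLp g 2 μ)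
    (hFf : Tendsto (fun k => eLpNorm (fun x => F k x - f x) 2 μ) atTop (𝓝 0))
    (hGg : Tendsto (fun k => eLpNorm (fun x => G k x - g x) 2 μ) atTop (𝓝 0)) :
    Tendsto (fun k => ∫ x, a x * inner ℝ (F k x) (G k x) ∂μ) atTop
      (𝓝 (∫ x, a x * inner ℝ (f x) (g x) ∂μ)) := by
  have h := tendsto_integral_inner (fun k => memLp_smul_of_bound ha hM (hF k))
    (memLp_smul_of_bound ha hM hf) hG hg (tendsto_eLpNorm_of_le_mul (M := M) (fun k => ?_) hFf) hGg
  · simpa only [real_inner_smul_left] using h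
  · filter_upwards [hM] with x hx
    rw [← smul_sub, norm_smul]
    exact mul_le_mul_of_nonneg_right hx (norm_nonneg _)

end L2

/-! ### The weighted estimates for functions in `H¹₀(Ω)` -/

/-- An inequality between weighted norms of test functions and of their gradients is inherited by
`H¹₀(Ω)`. -/
lemma MemH10.weighted_le {Ω : Set Plane} {u : Plane → ℝ} {Du : Plane → Plane} (hu : MemH10 Ω u Du)
    {a b : Plane → ℝ} (ha : Measurable a) (hb : Measurable b) {M N C : ℝ}
    (hM : ∀ᵐ x ∂volume.restrict Ω, |a x| ≤ M) (hN : ∀ᵐ x ∂volume.restrict Ω, |b x| ≤ N)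
    (h : ∀ φ : Plane → ℝ, IsTestFunction Ω φ →
      ∫ x in Ω, a x * φ x ^ 2 ≤ C * ∫ x in Ω, b x * ‖gradient φ x‖ ^ 2) :
    ∫ x in Ω, a x * u x ^ 2 ≤ C * ∫ x in Ω, b x * ‖Du x‖ ^ 2 := by
  obtain ⟨φ, hφ, hφu, hφD⟩ := hu.exists_approx
  have h1 := tendsto_integral_mul_inner ha.aestronglyMeasurable hM (fun k => (hφ k).memH10.memLp)
    hu.memLp (fun k => (hφ k).memH10.memLp) hu.memLp hφu hφu
  have h2 := tendsto_integral_mul_inner hb.aestronglyMeasurable hN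
    (fun k => (hφ k).memH10.memLp_grad) hu.memLp_grad (fun k => (hφ k).memH10.memLp_grad)
    hu.memLp_grad hφD hφD
  simp only [real_inner_self_eq_norm_sq, Real.norm_eq_abs, sq_abs] at h1 h2
  exact le_of_tendsto_of_tendsto' h1 (h2.const_mul C) fun k => h _ (hφ k)

/-- The energy estimate with weight `σ` in a convex domain. The equation is tested with `σ u`; the
term `(∇u, u ∇σ) = (∇(u²), ∇σ) / 2` is nonnegative because `σ` is superharmonic. -/
lemma IsWeakSolution.integral_regDist_mul_sq_le {Ω : Set Plane} (ho : IsOpen Ω)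
    (hb : Bornology.IsBounded Ω) (hconv : Convex ℝ Ω) (hne : (frontier Ω).Nonempty) {d S : ℝ}
    (hd : 0 < d) (hS : ∀ x ∈ Ω, regDist Ω d x ≤ S) {f u : Plane → ℝ} {Du : Plane → Plane}
    (hf : MemLp f 2 (volume.restrict Ω)) (hu : IsWeakSolution Ω f u Du) :
    ∫ x in Ω, regDist Ω d x * ‖Du x‖ ^ 2 ≤ ∫ x in Ω, regDist Ω d x * (f x * u x) := by
  set σ := regDist Ω d with hσ
  have hσL : LipschitzWith 1 σ := lipschitzWith_regDist Ω d
  have hσ0 : ∀ x, 0 < σ x := fun x => hd.trans_le (le_regDist Ω d x)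
  have hσb : ∀ x ∈ Ω, |σ x| ≤ S := fun x hx => by
    rw [abs_of_pos (hσ0 x)]; exact hS x hx
  have hσae : ∀ᵐ x ∂volume.restrict Ω, |σ x| ≤ S := by
    filter_upwards [ae_restrict_mem ho.measurableSet] with x hx using hσb x hx
  have hσm : AEStronglyMeasurable σ (volume.restrict Ω) := hσL.continuous.aestronglyMeasurable
  obtain ⟨φ, hφ, hφu, hφD⟩ := hu.memH10.exists_approx
  have mφ := fun k => (hφ k).memH10.memLp
  have mD := fun k => (hφ k).memH10.memLp_grad
  have mu := hu.memH10.memLp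
  have mDu := hu.memH10.memLp_grad
  have hGm : AEStronglyMeasurable (gradient σ) (volume.restrict Ω) :=
    (measurable_gradient σ).aestronglyMeasurable
  have hG1 : ∀ x, ‖gradient σ x‖ ≤ 1 := hσL.norm_gradient_le
  have mG : ∀ {g : Plane → ℝ}, MemLp g 2 (volume.restrict Ω) →
      MemLp (fun x => g x • gradient σ x) 2 (volume.restrict Ω) := fun {g} hg =>
    hg.of_le_mul (c := 1) (hg.aestronglyMeasurable.smul hGm) (Eventually.of_forall fun x => by
      rw [norm_smul, mul_comm]
      exact mul_le_mul_of_nonneg_right (hG1 x) (norm_nonneg _))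
  have hlimG : Tendsto (fun k => eLpNorm (fun x => φ k x • gradient σ x - u x • gradient σ x) 2
      (volume.restrict Ω)) atTop (𝓝 0) :=
    tendsto_eLpNorm_of_le_mul (M := 1) (fun k => Eventually.of_forall fun x => by
      rw [← sub_smul, norm_smul, mul_comm]
      exact mul_le_mul_of_nonneg_right (hG1 x) (norm_nonneg _)) hφu
  have hconst : Tendsto (fun _ : ℕ => eLpNorm (fun x => Du x - Du x) 2 (volume.restrict Ω)) atTop
      (𝓝 0) := by simp
  have hconstf : Tendsto (fun _ : ℕ => eLpNorm (fun x => f x - f x) 2 (volume.restrict Ω)) atTop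
      (𝓝 0) := by simp
  -- The additional term is nonnegative: this holds for the approximating test functions `φ k`, with
  -- `w = (φ k)²` as the function in the superharmonicity of `σ`.
  have hcross : 0 ≤ ∫ x in Ω, inner ℝ (Du x) (u x • gradient σ x) := by
    refine ge_of_tendsto' (tendsto_integral_inner mD mDu (fun k => mG (mφ k)) (mG mu) hφD hlimG)
      fun k => ?_
    obtain ⟨C, hC⟩ := (hφ k).mul_self.contDiff.lipschitzWith_of_hasCompactSupport
      (hφ k).mul_self.hasCompactSupport (by simp)
    have h := integral_inner_gradient_regDist_nonneg ho hconv hne d hC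
      (hφ k).mul_self.hasCompactSupport (hφ k).mul_self.tsupport_subset fun x => mul_self_nonneg _
    have heq : ∫ x in Ω, inner ℝ (gradient (φ k) x) (φ k x • gradient σ x) =
        1 / 2 * ∫ x, inner ℝ (gradient (fun x => φ k x * φ k x) x) (gradient σ x) := by
      rw [setIntegral_eq_integral_of_forall_compl_eq_zero, ← integral_const_mul]
      · congr 1
        ext x
        rw [(hφ k).gradient_mul_self, real_inner_smul_left, real_inner_smul_right]
        ring
      · intro x hx
        rw [gradient_eq_zero_of_notMem_tsupport fun h => hx ((hφ k).tsupport_subset h),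
          inner_zero_left]
    rw [heq]
    linarith
  have hS0 : 0 ≤ S := by
    have hΩ : Ω.Nonempty := by
      rw [Set.nonempty_iff_ne_empty]
      rintro rfl
      simp at hne
    obtain ⟨x, hx⟩ := hΩ
    exact (hσ0 x).le.trans (hS x hx)
  -- The weak formulation with the Lipschitz function `σ φ k`.
  have hweak : ∀ k, (∫ x in Ω, σ x * inner ℝ (Du x) (gradient (φ k) x)) +
      ∫ x in Ω, inner ℝ (Du x) (φ k x • gradient σ x) = ∫ x in Ω, σ x * inner ℝ (f x) (φ k x) := by
    intro k
    obtain ⟨C, hC⟩ := (hφ k).exists_lipschitzWith_mul hσL (N := S.toNNReal) fun x hx => by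
      rw [Real.coe_toNNReal _ hS0]; exact hσb x hx
    have h := hu.weak_form_of_lipschitz ho hb hf hC (hφ k).hasCompactSupport.mul_right
      (tsupport_mul_subset_left.trans (hφ k).tsupport_subset)
    have i1 : Integrable (fun x => σ x * inner ℝ (Du x) (gradient (φ k) x))
        (volume.restrict Ω) := by
      have := integrable_inner_of_memLp (memLp_smul_of_bound hσm hσae mDu) (mD k)
      simpa only [real_inner_smul_left] using this
    have i2 : Integrable (fun x => inner ℝ (Du x) (φ k x • gradient σ x)) (volume.restrict Ω) :=
      integrable_inner_of_memLp mDu (mG (mφ k))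
    rw [← integral_add i1 i2]
    refine Eq.trans ?_ (h.trans ?_)
    · refine integral_congr_ae (ae_restrict_of_ae ?_)
      filter_upwards [hσL.ae_differentiableAt] with x hx
      have h1 : DifferentiableAt ℝ (φ k) x := (hφ k).contDiff.differentiable (by simp) x
      have : gradient (fun x => φ k x * σ x) x = σ x • gradient (φ k) x + φ k x • gradient σ x := by
        refine ext_inner_right ℝ fun v => ?_
        rw [inner_gradient_left, inner_add_left, real_inner_smul_left, real_inner_smul_left,
          inner_gradient_left, inner_gradient_left, fderiv_fun_mul h1 hx]
        simp
        ring
      rw [this, inner_add_right, real_inner_smul_right _ (gradient (φ k) x)]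
    · congr 1
      ext x
      simp
      ring
  have l1 := tendsto_integral_mul_inner hσm hσae (fun _ => mDu) mDu mD mDu hconst hφD
  have l2 := tendsto_integral_inner (fun _ => mDu) mDu (fun k => mG (mφ k)) (mG mu) hconst hlimG
  have l3 := tendsto_integral_mul_inner hσm hσae (fun _ => hf) hf mφ mu hconstf hφu
  have hfinal := tendsto_nhds_unique (l1.add l2) (l3.congr fun k => (hweak k).symm)
  have e1 : ∫ x in Ω, σ x * inner ℝ (f x) (u x) = ∫ x in Ω, σ x * (f x * u x) := by
    congr 1
    ext x
    simp [mul_comm (f x)]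
  simp only [real_inner_self_eq_norm_sq] at hfinal
  rw [e1] at hfinal
  linarith

/-! ### The weighted norms and the final estimates -/

lemma rpow_regDist_le {Ω : Set Plane} {d S : ℝ} (hd : 0 < d) (hS : ∀ x ∈ Ω, regDist Ω d x ≤ S)
    (s : ℝ) {x : Plane} (hx : x ∈ Ω) : |regDist Ω d x ^ s| ≤ S ^ s + d ^ s := by
  have h1 := le_regDist Ω d x
  have h2 := hS x hx
  have h0 : 0 < regDist Ω d x := hd.trans_le h1
  have hS0 : 0 < S := h0.trans_le h2
  rw [abs_of_pos (Real.rpow_pos_of_pos h0 s)]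
  have hdp := Real.rpow_pos_of_pos hd s
  have hSp := Real.rpow_pos_of_pos hS0 s
  rcases le_total 0 s with hs | hs
  · linarith [Real.rpow_le_rpow h0.le h2 hs]
  · linarith [Real.rpow_le_rpow_of_nonpos hd h1 hs]

lemma memLp_rpow_regDist_smul {F : Type*} [NormedAddCommGroup F] [InnerProductSpace ℝ F]
    {Ω : Set Plane} (ho : IsOpen Ω) {d S : ℝ} (hd : 0 < d) (hS : ∀ x ∈ Ω, regDist Ω d x ≤ S) (s : ℝ)
    {w : Plane → F} (hw : MemLp w 2 (volume.restrict Ω)) :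
    MemLp (fun x => regDist Ω d x ^ s • w x) 2 (volume.restrict Ω) := by
  refine memLp_smul_of_bound (M := S ^ s + d ^ s)
    ((lipschitzWith_regDist Ω d).continuous.measurable.pow_const s).aestronglyMeasurable ?_ hw
  filter_upwards [ae_restrict_mem ho.measurableSet] with x hx using rpow_regDist_le hd hS s hx

lemma toReal_weightedL2Norm_sq {F : Type*} [NormedAddCommGroup F] [InnerProductSpace ℝ F]
    {Ω : Set Plane} (ho : IsOpen Ω) {d S : ℝ} (hd : 0 < d) (hS : ∀ x ∈ Ω, regDist Ω d x ≤ S)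
    (s : ℝ) {w : Plane → F} (hw : MemLp w 2 (volume.restrict Ω)) :
    (weightedL2Norm Ω d s w).toReal ^ 2 = ∫ x in Ω, regDist Ω d x ^ (2 * s) * ‖w x‖ ^ 2 := by
  rw [weightedL2Norm, toReal_eLpNorm_sq (memLp_rpow_regDist_smul ho hd hS s hw)]
  congr 1
  ext x
  have h0 : 0 < regDist Ω d x := hd.trans_le (le_regDist Ω d x)
  rw [norm_smul, mul_pow, Real.norm_of_nonneg (Real.rpow_nonneg h0.le _), mul_comm 2 s,
    Real.rpow_mul h0.le, Real.rpow_two]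

lemma integral_rpow_regDist_mul_le {Ω : Set Plane} (ho : IsOpen Ω) {d S : ℝ} (hd : 0 < d)
    (hS : ∀ x ∈ Ω, regDist Ω d x ≤ S) (s t : ℝ) {f u : Plane → ℝ}
    (hf : MemLp f 2 (volume.restrict Ω)) (hu : MemLp u 2 (volume.restrict Ω)) :
    ∫ x in Ω, regDist Ω d x ^ (s + t) * (f x * u x) ≤
      (weightedL2Norm Ω d s f).toReal * (weightedL2Norm Ω d t u).toReal := by
  refine Eq.trans_le ?_ (integral_inner_le_eLpNorm_mul_eLpNorm
    (memLp_rpow_regDist_smul ho hd hS s hf) (memLp_rpow_regDist_smul ho hd hS t hu))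
  congr 1
  ext x
  rw [Real.rpow_add (hd.trans_le (le_regDist Ω d x))]
  simp
  ring

lemma IsPolygonalDomain.exists_regDist_le {Ω : Set Plane} (hΩ : IsPolygonalDomain Ω)
    (hne : (frontier Ω).Nonempty) : ∃ R : ℝ, 0 < R ∧ ∀ d, ∀ x ∈ Ω, regDist Ω d x ≤ d + R := by
  obtain ⟨y, hy⟩ := hne
  obtain ⟨R, hR⟩ := hΩ.isBounded.subset_closedBall y
  refine ⟨max R 1, by positivity, fun d x hx => ?_⟩
  have h1 := Metric.infDist_le_dist_of_mem (x := x) hy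
  have h2 : dist x y ≤ R := hR hx
  rw [regDist]
  linarith [le_max_left R 1]

/-- The estimate in the unweighted energy norm, by Hardy's inequality. -/
lemma IsPolygonalDomain.exists_energy_estimate {Ω : Set Plane} (hΩ : IsPolygonalDomain Ω) :
    ∃ c : ℝ, 0 < c ∧ ∀ d : ℝ, 0 < d → ∀ (f u : Plane → ℝ) (Du : Plane → Plane),
      MemLp f 2 (volume.restrict Ω) → IsWeakSolution Ω f u Du →
        (weightedL2Norm Ω d (-1) u).toReal + (eLpNorm Du 2 (volume.restrict Ω)).toReal ≤
          c * (weightedL2Norm Ω d 1 f).toReal := by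
  obtain ⟨C, hC, hardy⟩ := hΩ.exists_hardy
  obtain ⟨R, hR, hS⟩ := hΩ.exists_regDist_le hΩ.frontier_nonempty
  refine ⟨C + √C, by positivity, fun d hd f u Du hf hu => ?_⟩
  have ho := hΩ.isOpen
  have hu2 := hu.memH10.memLp
  have hDu2 := hu.memH10.memLp_grad
  have hA := toReal_weightedL2Norm_sq ho hd (hS d) (-1) hu2
  have hG := toReal_eLpNorm_sq hDu2
  set a := (weightedL2Norm Ω d (-1) u).toReal
  set F := (weightedL2Norm Ω d 1 f).toReal with hF
  set G := (eLpNorm Du 2 (volume.restrict Ω)).toReal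
  have ha0 : 0 ≤ a := ENNReal.toReal_nonneg
  have hF0 : 0 ≤ F := ENNReal.toReal_nonneg
  have hG0 : 0 ≤ G := ENNReal.toReal_nonneg
  have h1 : G ^ 2 ≤ F * a := by
    have h := integral_rpow_regDist_mul_le ho hd (hS d) 1 (-1) hf hu2
    simp only [add_neg_cancel, Real.rpow_zero, one_mul] at h
    refine Eq.trans_le ?_ h
    rw [hG, ← hu.weak_form u Du hu.memH10]
    simp only [real_inner_self_eq_norm_sq]
  have h2 : a ^ 2 ≤ C * G ^ 2 := by
    have hm : Measurable (regDist Ω d) := (lipschitzWith_regDist Ω d).continuous.measurable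
    have h := hu.memH10.weighted_le (a := fun x => regDist Ω d x ^ (2 * -1 : ℝ)) (b := fun _ => 1)
      (M := (d + R) ^ (2 * -1 : ℝ) + d ^ (2 * -1 : ℝ)) (N := 1) (C := C) (hm.pow_const _)
      measurable_const ?_ (by simp) fun φ hφ => ?_
    · rw [hA, hG]
      simpa using h
    · filter_upwards [ae_restrict_mem ho.measurableSet] with x hx
      exact rpow_regDist_le hd (hS d) _ hx
    · refine Eq.trans_le ?_ ((hardy d hd φ hφ).trans_eq (by simp))
      congr 1
      ext x
      rw [inv_pow, mul_neg, mul_one, Real.rpow_neg (hd.le.trans (le_regDist Ω d x)), Real.rpow_two]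
  have h3 : a ≤ √C * G := by
    refine abs_le_of_sq_le_sq' ?_ (by positivity) |>.2
    rw [mul_pow, Real.sq_sqrt hC.le]
    exact h2
  have h4 : G ≤ √C * F := by
    rcases hG0.eq_or_lt with h0 | hpos
    · rw [← h0]; positivity
    · refine le_of_mul_le_mul_right ?_ hpos
      have := mul_le_mul_of_nonneg_left h3 hF0
      linarith
  have h5 : a ≤ C * F := by
    have := mul_le_mul_of_nonneg_left h4 (Real.sqrt_nonneg C)
    rw [← mul_assoc, Real.mul_self_sqrt hC.le] at this
    exact h3.trans this
  linarith

/-- The estimate with the weight `σ` in a convex domain, by the logarithmic Hardy inequality. -/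
lemma IsPolygonalDomain.exists_weighted_estimate {Ω : Set Plane} (hΩ : IsPolygonalDomain Ω)
    (hconv : Convex ℝ Ω) :
    ∃ c : ℝ, 0 < c ∧ ∀ d : ℝ, 0 < d → d < Real.exp (-1) →
      ∀ (f u : Plane → ℝ) (Du : Plane → Plane),
        MemLp f 2 (volume.restrict Ω) → IsWeakSolution Ω f u Du →
          (weightedL2Norm Ω d (-1 / 2) u).toReal +
              |Real.log d| * (weightedL2Norm Ω d (1 / 2) Du).toReal ≤
            c * |Real.log d| ^ 2 * (weightedL2Norm Ω d (3 / 2) f).toReal := by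
  have hne := hΩ.frontier_nonempty
  obtain ⟨R, hR, hS⟩ := hΩ.exists_regDist_le hne
  set K := 1 + Real.log (1 + R) with hK
  have hlR : 0 ≤ Real.log (1 + R) := Real.log_nonneg (by linarith)
  have hK0 : 0 < K := by linarith
  refine ⟨4 * K ^ 2 + 2 * K, by positivity, fun d hd hde f u Du hf hu => ?_⟩
  have ho := hΩ.isOpen
  have hu2 := hu.memH10.memLp
  have hDu2 := hu.memH10.memLp_grad
  -- As `d < 1 / e`, the logarithm of `d` dominates the constant `log (1 + R)`.
  have hld : Real.log d < -1 := (Real.log_lt_iff_lt_exp hd).2 hde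
  set l := |Real.log d| with hl
  have hl1 : 1 ≤ l := by
    rw [hl, abs_of_neg (by linarith)]
    linarith
  set L := Real.log ((d + R) / d) with hL
  have hL0 : 0 ≤ L := Real.log_nonneg ((one_le_div hd).2 (by linarith))
  have hLK : L ≤ K * l := by
    have hd1 : d < 1 := (Real.log_neg_iff hd).1 (by linarith)
    have h1 : Real.log (d + R) ≤ Real.log (1 + R) := Real.log_le_log (by linarith) (by linarith)
    have h2 : Real.log (1 + R) ≤ Real.log (1 + R) * l := le_mul_of_one_le_right hlR hl1
    have h3 : l = - Real.log d := by rw [hl, abs_of_neg (by linarith)]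
    rw [hL, Real.log_div (by linarith) hd.ne', hK]
    linarith
  have hB := toReal_weightedL2Norm_sq ho hd (hS d) (-1 / 2) hu2
  have hA := toReal_weightedL2Norm_sq ho hd (hS d) (1 / 2) hDu2
  have hFB := integral_rpow_regDist_mul_le ho hd (hS d) (3 / 2) (-1 / 2) hf hu2
  have e1 : (2 : ℝ) * (-1 / 2) = -1 := by norm_num
  have e2 : (2 : ℝ) * (1 / 2) = 1 := by norm_num
  have e3 : (3 / 2 : ℝ) + -1 / 2 = 1 := by norm_num
  simp only [e1, e2, e3, Real.rpow_one, Real.norm_eq_abs, sq_abs] at hA hB hFB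
  set B := (weightedL2Norm Ω d (-1 / 2) u).toReal
  set F := (weightedL2Norm Ω d (3 / 2) f).toReal
  set A := (weightedL2Norm Ω d (1 / 2) Du).toReal
  have hB0 : 0 ≤ B := ENNReal.toReal_nonneg
  have hF0 : 0 ≤ F := ENNReal.toReal_nonneg
  have hA0 : 0 ≤ A := ENNReal.toReal_nonneg
  have h1 : A ^ 2 ≤ F * B := by
    rw [hA]
    exact (hu.integral_regDist_mul_sq_le ho hΩ.isBounded hconv hne hd (hS d) hf).trans hFB
  have h2 : B ^ 2 ≤ 4 * L ^ 2 * A ^ 2 := by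
    have hm : Measurable (regDist Ω d) := (lipschitzWith_regDist Ω d).continuous.measurable
    rw [hA, hB]
    refine hu.memH10.weighted_le (M := (d + R) ^ (-1 : ℝ) + d ^ (-1 : ℝ)) (N := d + R)
      (hm.pow_const _) hm ?_ ?_ fun φ hφ => ?_
    · filter_upwards [ae_restrict_mem ho.measurableSet] with x hx
      exact rpow_regDist_le hd (hS d) _ hx
    · filter_upwards [ae_restrict_mem ho.measurableSet] with x hx
      rw [abs_of_pos (hd.trans_le (le_regDist Ω d x))]
      exact hS d x hx
    · simp only [Real.rpow_neg_one]
      exact hφ.weighted_hardy ho hconv hΩ.isCompact_frontier hne hd (by linarith) (hS d)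
  have h3 : B ≤ 2 * L * A := by
    refine abs_le_of_sq_le_sq' ?_ (by positivity) |>.2
    linarith [h2]
  have h4 : A ≤ 2 * L * F := by
    rcases hA0.eq_or_lt with h0 | hpos
    · rw [← h0]; positivity
    · refine le_of_mul_le_mul_right ?_ hpos
      have := mul_le_mul_of_nonneg_left h3 hF0
      linarith
  have h5 : A ≤ 2 * (K * l) * F := h4.trans (by gcongr)
  have h6 : B ≤ 2 * (K * l) * (2 * (K * l) * F) := h3.trans (by gcongr)
  have h7 : l * A ≤ l * (2 * (K * l) * F) := by gcongr
  linarith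

theorem mainTheorem6 (Ω : Set Plane) (hΩ : IsPolygonalDomain Ω) :
    ∃ c : ℝ, 0 < c ∧ ∀ d : ℝ, 0 < d → d < Real.exp (-1) →
      ∀ (f u : Plane → ℝ) (Du : Plane → Plane),
        MemLp f 2 (volume.restrict Ω) → IsWeakSolution Ω f u Du →
          (weightedL2Norm Ω d (-1) u + eLpNorm Du 2 (volume.restrict Ω) ≤
            ENNReal.ofReal c * weightedL2Norm Ω d 1 f) ∧
          (Convex ℝ Ω →
            weightedL2Norm Ω d (-1 / 2) u +
                ENNReal.ofReal |Real.log d| * weightedL2Norm Ω d (1 / 2) Du ≤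
              ENNReal.ofReal (c * |Real.log d| ^ 2) * weightedL2Norm Ω d (3 / 2) f) := by
  obtain ⟨c₁, hc₁, H₁⟩ := hΩ.exists_energy_estimate
  obtain ⟨c₂, hc₂, H₂⟩ : ∃ c : ℝ, 0 < c ∧ (Convex ℝ Ω → ∀ d : ℝ, 0 < d → d < Real.exp (-1) →
      ∀ (f u : Plane → ℝ) (Du : Plane → Plane),
        MemLp f 2 (volume.restrict Ω) → IsWeakSolution Ω f u Du →
          (weightedL2Norm Ω d (-1 / 2) u).toReal +
              |Real.log d| * (weightedL2Norm Ω d (1 / 2) Du).toReal ≤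
            c * |Real.log d| ^ 2 * (weightedL2Norm Ω d (3 / 2) f).toReal) := by
    by_cases hconv : Convex ℝ Ω
    · obtain ⟨c, hc, H⟩ := hΩ.exists_weighted_estimate hconv
      exact ⟨c, hc, fun _ => H⟩
    · exact ⟨1, one_pos, fun h => absurd h hconv⟩
  obtain ⟨R, hR, hS⟩ := hΩ.exists_regDist_le hΩ.frontier_nonempty
  refine ⟨c₁ + c₂, by positivity, fun d hd hde f u Du hf hu => ?_⟩
  have hu2 := hu.memH10.memLp
  have hDu2 := hu.memH10.memLp_grad
  have nf : ∀ s, weightedL2Norm Ω d s f = ENNReal.ofReal (weightedL2Norm Ω d s f).toReal := fun s =>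
    (ENNReal.ofReal_toReal (memLp_rpow_regDist_smul hΩ.isOpen hd (hS d) s hf).eLpNorm_ne_top).symm
  have nu : ∀ s, weightedL2Norm Ω d s u = ENNReal.ofReal (weightedL2Norm Ω d s u).toReal := fun s =>
    (ENNReal.ofReal_toReal (memLp_rpow_regDist_smul hΩ.isOpen hd (hS d) s hu2).eLpNorm_ne_top).symm
  have nD : ∀ s, weightedL2Norm Ω d s Du = ENNReal.ofReal (weightedL2Norm Ω d s Du).toReal :=
    fun s =>
    (ENNReal.ofReal_toReal (memLp_rpow_regDist_smul hΩ.isOpen hd (hS d) s hDu2).eLpNorm_ne_top).symm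
  constructor
  · rw [nf, nu, ← ENNReal.ofReal_toReal hDu2.eLpNorm_ne_top,
      ← ENNReal.ofReal_add ENNReal.toReal_nonneg ENNReal.toReal_nonneg,
      ← ENNReal.ofReal_mul (by positivity)]
    refine ENNReal.ofReal_le_ofReal ((H₁ d hd f u Du hf hu).trans ?_)
    exact mul_le_mul_of_nonneg_right (by linarith) ENNReal.toReal_nonneg
  · intro hconv
    rw [nf, nu, nD, ← ENNReal.ofReal_mul (by positivity), ← ENNReal.ofReal_mul (by positivity),
      ← ENNReal.ofReal_add ENNReal.toReal_nonneg (mul_nonneg (abs_nonneg _) ENNReal.toReal_nonneg)]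
    refine ENNReal.ofReal_le_ofReal ((H₂ hconv d hd hde f u Du hf hu).trans ?_)
    refine mul_le_mul_of_nonneg_right ?_ ENNReal.toReal_nonneg
    exact mul_le_mul_of_nonneg_right (by linarith) (by positivity)
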